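/- Let $k\ge 1$. Let $J^k(\mathbb R)$ be $\mathbb R^{k+2}$, with points written $(x,u_k,\ldots,u_0)$, equipped with the group law \[ (x,u_k,\ldots,u_0)\odot(y,v_k,\ldots,v_0)=(x+y,w_k,\ldots,w_0),\qquad w_s=u_s+v_s+\sum_{j=s+1}^k u_j\frac{y^{j-s}}{(j-s)!}\quad(0\le s\le k), \] and with its Carnot–Carathéodory metric: the distance between two points is the infimum of the lengths $\int\sqrt{\dot x^2+\dot u_k^2}$ of the curves joining them that are absolutely continuous in $\mathbb R^{k+2}$ and satisfy $\dot u_j=u_{j+1}\dot x$ almost everywhere for $0\le j\le k-1$. For a smooth function $f:\mathbb R\to\mathbb R$ let $j^k_x(f)=(x,f^{(k)}(x),\ldots,f'(x),f(x))$, and for $t\in\mathbb R$ let $V_{f,t}:J^k(\mathbb R)\to\{x=t\}$ be the vertical mapping \[ V_{f,t}(p)=p\odot j^k_{x-t}(f)^{-1},\qquad p=(x,u_k,\ldots,u_0). \] Theorem. For all $t\in\mathbb R$, all $m,b\in\mathbb R$ with $m\neq 0$, all $0\le\mu\le1$ and all $0\le\beta\le(k+1)\mu$, there exists a Borel set $E\subset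 J^k(\mathbb R)$ such that, for $f(x)=mx+b$, \[ \dim_H E=\mu\qquad\text{and}\qquad \dim_H V_{f,t}(E)=\beta, \] where $\dim_H$ is the Hausdorff dimension with respect to the Carnot–Carathéodory metric. -/

import Mathlib

open MeasureTheory Set
open scoped ENNReal NNReal Nat

/-- The jet space `J^k(ℝ)`, identified with `ℝ^(k+2)`: a point `(x, u_k, …, u_0)` is given by its
base point `x` and its coordinates `u j`, `j = 0, …, k`. -/
@[ext]
structure JetSpace (k : ℕ) where
  /-- the base point -/
  x : ℝ
  /-- the coordinates `u_0, …, u_k` -/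
  u : Fin (k + 1) → ℝ

namespace JetSpace

variable {k : ℕ}

/-! ### The group structure -/

/-- The group law `(x, u) ⊙ (y, v) = (x + y, w)`,
`w_s = u_s + v_s + ∑_{j > s} u_j y^(j-s) / (j-s)!`. -/
noncomputable instance : Mul (JetSpace k) where
  mul p q :=
    { x := p.x + q.x
      u := fun s => p.u s + q.u s +
        ∑ j ∈ Finset.Ioi s, p.u j * (q.x ^ ((j : ℕ) - (s : ℕ)) / (((j : ℕ) - (s : ℕ))! : ℝ)) }

noncomputable instance : One (JetSpace k) where
  one := { x := 0, u := fun _ => 0 }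

noncomputable instance : Inv (JetSpace k) where
  inv p :=
    { x := -p.x
      u := fun s => -∑ j ∈ Finset.Ici s,
        p.u j * ((-p.x) ^ ((j : ℕ) - (s : ℕ)) / (((j : ℕ) - (s : ℕ))! : ℝ)) }

/-- Auxiliary: re-expansion of a Taylor polynomial at a point translated by `y`. -/
noncomputable def shift (y : ℝ) (u : Fin (k + 1) → ℝ) (s : Fin (k + 1)) : ℝ :=
  ∑ j ∈ Finset.Ici s, u j * (y ^ ((j : ℕ) - (s : ℕ)) / (((j : ℕ) - (s : ℕ))! : ℝ))

lemma shift_add (y : ℝ) (u v : Fin (k + 1) → ℝ) (s : Fin (k + 1)) :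
    shift y (fun j => u j + v j) s = shift y u s + shift y v s := by
  simp only [shift, add_mul, Finset.sum_add_distrib]

lemma shift_neg (y : ℝ) (u : Fin (k + 1) → ℝ) (s : Fin (k + 1)) :
    shift y (fun j => - u j) s = - shift y u s := by
  simp only [shift, neg_mul, Finset.sum_neg_distrib]

lemma shift_eq (y : ℝ) (u : Fin (k + 1) → ℝ) (s : Fin (k + 1)) :
    shift y u s = u s +
      ∑ j ∈ Finset.Ioi s, u j * (y ^ ((j : ℕ) - (s : ℕ)) / (((j : ℕ) - (s : ℕ))! : ℝ)) := by
  rw [shift, ← Finset.Ioi_insert, Finset.sum_insert (by simp)]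
  simp

lemma shift_zero (u : Fin (k + 1) → ℝ) (s : Fin (k + 1)) : shift 0 u s = u s := by
  rw [shift_eq, Finset.sum_eq_zero, add_zero]
  intro j hj
  have h : (s : ℕ) < j := by simpa using hj
  rw [zero_pow (by omega)]
  simp

lemma sum_pow_div (y z : ℝ) (s j : Fin (k + 1)) (h : s ≤ j) :
    ∑ i ∈ Finset.Icc s j, z ^ ((j : ℕ) - (i : ℕ)) / (((j : ℕ) - (i : ℕ))! : ℝ) *
      (y ^ ((i : ℕ) - (s : ℕ)) / (((i : ℕ) - (s : ℕ))! : ℝ)) =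
    (y + z) ^ ((j : ℕ) - (s : ℕ)) / (((j : ℕ) - (s : ℕ))! : ℝ) := by
  have hs : (s : ℕ) ≤ j := h
  rw [add_pow, Finset.sum_div]
  refine Finset.sum_bij (fun i _ => (i : ℕ) - (s : ℕ)) ?_ ?_ ?_ ?_
  · intro i hi
    have h1 : (s : ℕ) ≤ i ∧ (i : ℕ) ≤ j := by simpa using hi
    simp only [Finset.mem_range]
    omega
  · intro i hi i' hi' hh
    have h1 : (s : ℕ) ≤ i ∧ (i : ℕ) ≤ j := by simpa using hi
    have h2 : (s : ℕ) ≤ i' ∧ (i' : ℕ) ≤ j := by simpa using hi'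
    apply Fin.ext
    omega
  · intro m hm
    have hm' : m < (j : ℕ) - s + 1 := by simpa using hm
    refine ⟨⟨m + s, by omega⟩, ?_, ?_⟩
    · simp only [Finset.mem_Icc, Fin.le_def]
      omega
    · simp
  · intro i hi
    have h1 : (s : ℕ) ≤ i ∧ (i : ℕ) ≤ j := by simpa using hi
    have h3 : (j : ℕ) - s - (i - s) = j - i := by omega
    have h4 := Nat.choose_mul_factorial_mul_factorial (n := (j : ℕ) - s) (k := (i : ℕ) - s)
      (by omega)
    rw [h3] at h4 ⊢
    have h5 : ((((j : ℕ) - s).choose ((i : ℕ) - s) : ℕ) : ℝ) * ((((i : ℕ) - s)! : ℕ) : ℝ) *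
      ((((j : ℕ) - i)! : ℕ) : ℝ) = ((((j : ℕ) - s)! : ℕ) : ℝ) := by exact_mod_cast h4
    have p1 : ((((i : ℕ) - s)! : ℕ) : ℝ) ≠ 0 := by positivity
    have p2 : ((((j : ℕ) - i)! : ℕ) : ℝ) ≠ 0 := by positivity
    have p3 : ((((j : ℕ) - s)! : ℕ) : ℝ) ≠ 0 := by positivity
    rw [div_mul_div_comm, div_eq_div_iff (mul_ne_zero p2 p1) p3, ← h5]
    ring

lemma shift_shift (y z : ℝ) (u : Fin (k + 1) → ℝ) (s : Fin (k + 1)) :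
    shift y (shift z u) s = shift (y + z) u s := by
  simp only [shift, Finset.sum_mul]
  rw [Finset.sum_comm' (t' := Finset.Ici s) (s' := fun j => Finset.Icc s j)]
  · refine Finset.sum_congr rfl fun j hj => ?_
    rw [← sum_pow_div y z s j (by simpa using hj), Finset.mul_sum]
    refine Finset.sum_congr rfl fun i _ => ?_
    ring
  · intro i j
    simp only [Finset.mem_Ici, Finset.mem_Icc]
    constructor
    · rintro ⟨h1, h2⟩
      exact ⟨⟨h1, h2⟩, h1.trans h2⟩
    · rintro ⟨⟨h1, h2⟩, _⟩
      exact ⟨h1, h2⟩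

@[simp] lemma mul_x (p q : JetSpace k) : (p * q).x = p.x + q.x := rfl

lemma mul_u (p q : JetSpace k) (s : Fin (k + 1)) :
    (p * q).u s = q.u s + shift q.x p.u s := by
  rw [shift_eq]
  change p.u s + q.u s + _ = _
  ring

@[simp] lemma one_x : (1 : JetSpace k).x = 0 := rfl

@[simp] lemma one_u (s : Fin (k + 1)) : (1 : JetSpace k).u s = 0 := rfl

@[simp] lemma inv_x (p : JetSpace k) : (p⁻¹).x = -p.x := rfl

lemma inv_u (p : JetSpace k) (s : Fin (k + 1)) : (p⁻¹).u s = -shift (-p.x) p.u s := rfl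

noncomputable instance : Group (JetSpace k) :=
  Group.ofLeftAxioms
    (by
      intro p q r
      ext s
      · simp only [mul_x]
        ring
      · have h1 : (p * q).u = fun j => q.u j + shift q.x p.u j := funext fun j => mul_u p q j
        rw [mul_u, mul_u, mul_u, h1, shift_add, mul_x]
        have h2 := shift_shift r.x q.x p.u s
        rw [h2, add_comm q.x]
        ring)
    (by
      intro p
      ext s
      · simp
      · rw [mul_u]
        simp [shift])
    (by
      intro p
      ext s
      · simp
      · have h1 : (p⁻¹).u = fun j => -shift (-p.x) p.u j := funext fun j => inv_u p j
        rw [mul_u, h1, shift_neg, shift_shift, add_neg_cancel, shift_zero, one_u, add_neg_cancel])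

/-! ### The Carnot–Carathéodory distance -/

/-- `γ` is a horizontal curve on `[a, b]`: all its coordinates are absolutely continuous and, at
almost every time, its velocity is annihilated by the contact forms `du_j - u_{j+1} dx`,
`j = 0, …, k - 1`. -/
structure IsHorizontal (γ : ℝ → JetSpace k) (a b : ℝ) : Prop where
  ac_x : AbsolutelyContinuousOnInterval (fun s => (γ s).x) a b
  ac_u : ∀ j, AbsolutelyContinuousOnInterval (fun s => (γ s).u j) a b
  contact : ∀ᵐ s, s ∈ Icc a b → ∀ j : Fin k,
    deriv (fun r => (γ r).u j.castSucc) s = (γ s).u j.succ * deriv (fun r => (γ r).x) s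

/-- The length on `[a, b]` of a horizontal curve, for the left-invariant inner product on the
horizontal bundle that makes its frame `∂_x + u_k ∂_{u_{k-1}} + ⋯ + u_1 ∂_{u_0}`, `∂_{u_k}`
orthonormal: the components of the velocity in this frame are `x'` and `u_k'`. -/
noncomputable def length (γ : ℝ → JetSpace k) (a b : ℝ) : ℝ≥0∞ :=
  ∫⁻ s in Icc a b, ENNReal.ofReal
    (√(deriv (fun r => (γ r).x) s ^ 2 + deriv (fun r => (γ r).u (Fin.last k)) s ^ 2))

/-- The Carnot–Carathéodory distance: the infimum of the lengths of the horizontal curves from `p`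
to `q` (a priori in `[0, ∞]`). -/
noncomputable def ccEDist (p q : JetSpace k) : ℝ≥0∞ :=
  ⨅ (γ : ℝ → JetSpace k) (a : ℝ) (b : ℝ) (_ : a ≤ b ∧ IsHorizontal γ a b ∧ γ a = p ∧ γ b = q),
    length γ a b

lemma ccEDist_le {p q : JetSpace k} {γ : ℝ → JetSpace k} {a b : ℝ} (hab : a ≤ b)
    (h : IsHorizontal γ a b) (ha : γ a = p) (hb : γ b = q) : ccEDist p q ≤ length γ a b :=
  iInf_le_of_le γ <| iInf_le_of_le a <| iInf_le_of_le b <| iInf_le_of_le ⟨hab, h, ha, hb⟩ le_rfl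

lemma exists_of_ccEDist_lt {p q : JetSpace k} {c : ℝ≥0∞} (h : ccEDist p q < c) :
    ∃ (γ : ℝ → JetSpace k) (a b : ℝ), a ≤ b ∧ IsHorizontal γ a b ∧ γ a = p ∧ γ b = q ∧
      length γ a b < c := by
  simp only [ccEDist, iInf_lt_iff] at h
  obtain ⟨γ, a, b, ⟨h1, h2, h3, h4⟩, h5⟩ := h
  exact ⟨γ, a, b, h1, h2, h3, h4, h5⟩

lemma ac_const (c a b : ℝ) : AbsolutelyContinuousOnInterval (fun _ : ℝ => c) a b :=
  ((LipschitzWith.const c).lipschitzOnWith (K := 0)).absolutelyContinuousOnInterval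

lemma ccEDist_self (p : JetSpace k) : ccEDist p p = 0 := by
  have h : IsHorizontal (fun _ => p) 0 0 :=
    ⟨ac_const _ _ _, fun j => ac_const _ _ _, by simp⟩
  have := ccEDist_le le_rfl h rfl rfl
  simpa [length] using this

lemma ac_comp {f θ : ℝ → ℝ} {a b c d : ℝ} (hf : AbsolutelyContinuousOnInterval f c d)
    (hθ : Monotone θ ∨ Antitone θ) (hL : ∀ s t, dist (θ s) (θ t) ≤ dist s t)
    (hm : ∀ s ∈ uIcc a b, θ s ∈ uIcc c d) :
    AbsolutelyContinuousOnInterval (fun s => f (θ s)) a b := by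
  rw [absolutelyContinuousOnInterval_iff] at hf ⊢
  intro ε hε
  obtain ⟨δ, hδ, H⟩ := hf ε hε
  refine ⟨δ, hδ, fun E hE hlt => ?_⟩
  refine H (E.1, fun i => (θ (E.2 i).1, θ (E.2 i).2)) ⟨?_, ?_⟩ ?_
  · intro i hi
    exact ⟨hm _ (hE.1 i hi).1, hm _ (hE.1 i hi).2⟩
  · intro i hi j hj hij
    have h := hE.2 hi hj hij
    simp only [Function.onFun, uIoc, Set.Ioc_disjoint_Ioc] at h ⊢
    rcases hθ with hθ | hθ
    · rw [← hθ.map_max, ← hθ.map_max, ← hθ.map_min, ← hθ.map_min, ← hθ.map_min, ← hθ.map_max]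
      exact hθ h
    · rw [← hθ.map_min, ← hθ.map_min, ← hθ.map_max, ← hθ.map_max, ← hθ.map_max, ← hθ.map_min]
      refine hθ ?_
      exact h
  · exact lt_of_le_of_lt (Finset.sum_le_sum fun i _ => hL _ _) hlt

lemma ccEDist_comm_le (p q : JetSpace k) : ccEDist q p ≤ ccEDist p q := by
  refine le_of_forall_gt fun c hc => ?_
  obtain ⟨γ, a, b, hab, h, ha, hb, hl⟩ := exists_of_ccEDist_lt hc
  have hd : ∀ (f : ℝ → ℝ) (s : ℝ), deriv (fun r => f (-r)) s = -deriv f (-s) :=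
    fun f s => deriv_comp_neg f s
  have hmp := (Measure.measurePreserving_neg (volume : Measure ℝ))
  have hH : IsHorizontal (fun s => γ (-s)) (-b) (-a) := by
    refine ⟨?_, fun j => ?_, ?_⟩
    · refine ac_comp (f := fun s => (γ s).x) h.ac_x (θ := fun s => -s)
        (Or.inr fun s t hst => neg_le_neg hst) ?_ ?_
      · intro s t
        simp
      · intro s hs
        rw [uIcc_of_le (neg_le_neg hab)] at hs
        rw [uIcc_of_le hab]
        exact ⟨by linarith [hs.2], by linarith [hs.1]⟩
    · refine ac_comp (f := fun s => (γ s).u j) (h.ac_u j) (θ := fun s => -s)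
        (Or.inr fun s t hst => neg_le_neg hst) ?_ ?_
      · intro s t
        simp
      · intro s hs
        rw [uIcc_of_le (neg_le_neg hab)] at hs
        rw [uIcc_of_le hab]
        exact ⟨by linarith [hs.2], by linarith [hs.1]⟩
    · have h1 := hmp.quasiMeasurePreserving.ae h.contact
      filter_upwards [h1] with s hs hmem j
      have h2 := hs ⟨by linarith [hmem.2], by linarith [hmem.1]⟩ j
      rw [hd (fun r => (γ r).u j.castSucc) s, hd (fun r => (γ r).x) s, h2]
      ring
  refine (ccEDist_le (neg_le_neg hab) hH (by simpa using hb) (by simpa using ha)).trans_lt ?_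
  refine lt_of_eq_of_lt ?_ hl
  have hpre : (fun s : ℝ => -s) ⁻¹' Icc a b = Icc (-b) (-a) := by
    ext s
    simp only [mem_preimage, mem_Icc]
    constructor <;> rintro ⟨h1, h2⟩ <;> constructor <;> linarith
  have := hmp.setLIntegral_comp_preimage_emb (MeasurableEquiv.neg ℝ).measurableEmbedding
    (fun s => ENNReal.ofReal
      (√(deriv (fun r => (γ r).x) s ^ 2 + deriv (fun r => (γ r).u (Fin.last k)) s ^ 2))) (Icc a b)
  rw [length, length, ← this]
  change _ = ∫⁻ s in (fun s : ℝ => -s) ⁻¹' Icc a b, _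
  rw [hpre]
  refine lintegral_congr fun s => ?_
  rw [hd (fun r => (γ r).u (Fin.last k)) s, hd (fun r => (γ r).x) s]
  simp

lemma ccEDist_comm (p q : JetSpace k) : ccEDist p q = ccEDist q p :=
  le_antisymm (ccEDist_comm_le q p) (ccEDist_comm_le p q)

/-- Auxiliary: the concatenation at time `b` of two functions, the second one translated by `τ`. -/
noncomputable def glue {α : Type*} (f g : ℝ → α) (b τ : ℝ) (s : ℝ) : α :=
  if s ≤ b then f s else g (s + τ)

lemma glue_ac {f g : ℝ → ℝ} {a b c d : ℝ} (hab : a ≤ b) (hcd : c ≤ d)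
    (hf : AbsolutelyContinuousOnInterval f a b) (hg : AbsolutelyContinuousOnInterval g c d)
    (hfg : f b = g c) :
    AbsolutelyContinuousOnInterval (glue f g b (c - b)) a (b + (d - c)) := by
  have h1 : AbsolutelyContinuousOnInterval (fun s => f (min s b)) a (b + (d - c)) := by
    refine ac_comp hf (θ := fun s => min s b)
      (Or.inl fun s t hst => min_le_min hst le_rfl) ?_ ?_
    · intro s t
      simpa [Real.dist_eq] using abs_min_sub_min_le_max s b t b
    · intro s hs
      rw [uIcc_of_le (by linarith)] at hs
      rw [uIcc_of_le hab]
      exact ⟨le_min hs.1 hab, min_le_right _ _⟩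
  have h2 : AbsolutelyContinuousOnInterval (fun s => g (max (s + (c - b)) c)) a (b + (d - c)) := by
    refine ac_comp hg (θ := fun s => max (s + (c - b)) c)
      (Or.inl fun s t hst => max_le_max (by linarith) le_rfl) ?_ ?_
    · intro s t
      have := abs_max_sub_max_le_max (s + (c - b)) c (t + (c - b)) c
      simpa [Real.dist_eq] using this
    · intro s hs
      rw [uIcc_of_le (by linarith)] at hs
      rw [uIcc_of_le hcd]
      exact ⟨le_max_right _ _, max_le (by linarith [hs.2]) hcd⟩
  have h3 := (h1.fun_add h2).fun_sub (ac_const (g c) a (b + (d - c)))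
  have h4 : glue f g b (c - b) = fun s => f (min s b) + g (max (s + (c - b)) c) - g c := by
    funext s
    unfold glue
    split_ifs with hs
    · rw [min_eq_left hs, max_eq_right (by linarith)]
      ring
    · push Not at hs
      rw [min_eq_right hs.le, max_eq_left (by linarith), hfg]
      ring
  rw [h4]
  exact h3

lemma glue_deriv_left (f g : ℝ → ℝ) {b τ s : ℝ} (hs : s < b) :
    deriv (glue f g b τ) s = deriv f s := by
  apply Filter.EventuallyEq.deriv_eq
  filter_upwards [Iio_mem_nhds hs] with r hr
  exact if_pos (le_of_lt hr)

lemma glue_deriv_right (f g : ℝ → ℝ) {b τ s : ℝ} (hs : b < s) :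
    deriv (glue f g b τ) s = deriv g (s + τ) := by
  rw [← deriv_comp_add_const]
  apply Filter.EventuallyEq.deriv_eq
  filter_upwards [Ioi_mem_nhds hs] with r hr
  exact if_neg (not_le_of_gt hr)

lemma ccEDist_triangle_aux {p q r : JetSpace k} {γ₁ γ₂ : ℝ → JetSpace k} {a b c d : ℝ}
    (hab : a ≤ b) (h₁ : IsHorizontal γ₁ a b) (ha : γ₁ a = p) (hb : γ₁ b = q)
    (hcd : c ≤ d) (h₂ : IsHorizontal γ₂ c d) (hc : γ₂ c = q) (hd : γ₂ d = r) :
    ccEDist p r ≤ length γ₁ a b + length γ₂ c d := by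
  have hgx : (fun s => (glue γ₁ γ₂ b (c - b) s).x) =
      glue (fun s => (γ₁ s).x) (fun s => (γ₂ s).x) b (c - b) := by
    funext s
    unfold glue
    split_ifs <;> rfl
  have hgu : ∀ j, (fun s => (glue γ₁ γ₂ b (c - b) s).u j) =
      glue (fun s => (γ₁ s).u j) (fun s => (γ₂ s).u j) b (c - b) := by
    intro j
    funext s
    unfold glue
    split_ifs <;> rfl
  have hH : IsHorizontal (glue γ₁ γ₂ b (c - b)) a (b + (d - c)) := by
    refine ⟨?_, fun j => ?_, ?_⟩
    · rw [hgx]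
      exact glue_ac hab hcd h₁.ac_x h₂.ac_x (by rw [hb, hc])
    · rw [hgu]
      exact glue_ac hab hcd (h₁.ac_u j) (h₂.ac_u j) (by rw [hb, hc])
    · have h3 := (measurePreserving_add_right (volume : Measure ℝ)
        (c - b)).quasiMeasurePreserving.ae h₂.contact
      have h4 : ∀ᵐ s : ℝ, s ≠ b := by simp [ae_iff]
      filter_upwards [h₁.contact, h3, h4] with s hs₁ hs₂ hsb hmem j
      rw [hgx, hgu]
      rcases lt_or_gt_of_ne hsb with hlt | hgt
      · rw [glue_deriv_left _ _ hlt, glue_deriv_left _ _ hlt, hs₁ ⟨hmem.1, hlt.le⟩ j, glue,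
          if_pos hlt.le]
      · rw [glue_deriv_right _ _ hgt, glue_deriv_right _ _ hgt,
          hs₂ ⟨by linarith, by linarith [hmem.2]⟩ j, glue, if_neg (not_le_of_gt hgt)]
  have hend : glue γ₁ γ₂ b (c - b) (b + (d - c)) = r := by
    unfold glue
    split_ifs with h
    · have hdc : d = c := by linarith
      rw [hdc, sub_self, add_zero, hb, ← hc, ← hdc, hd]
    · rw [← hd]
      congr 1
      ring
  refine (ccEDist_le (by linarith) hH (by rw [glue, if_pos hab, ha]) hend).trans ?_
  have hsub : Icc a (b + (d - c)) ⊆ Iio b ∩ Icc a b ∪ ({b} ∪ Ioc b (b + (d - c))) := by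
    intro s hs
    rcases lt_trichotomy s b with h | h | h
    · exact Or.inl ⟨h, hs.1, h.le⟩
    · exact Or.inr (Or.inl h)
    · exact Or.inr (Or.inr ⟨h, hs.2⟩)
  have hpre : (fun s : ℝ => s + (c - b)) ⁻¹' Icc c d = Icc b (b + (d - c)) := by
    ext s
    simp only [mem_preimage, mem_Icc]
    constructor <;> rintro ⟨h1, h2⟩ <;> constructor <;> linarith
  have htr := (measurePreserving_add_right (volume : Measure ℝ)
    (c - b)).setLIntegral_comp_preimage_emb (measurableEmbedding_addRight (c - b))
    (fun s => ENNReal.ofReal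
      (√(deriv (fun r => (γ₂ r).x) s ^ 2 + deriv (fun r => (γ₂ r).u (Fin.last k)) s ^ 2))) (Icc c d)
  rw [hpre] at htr
  unfold length
  rw [hgx, hgu, ← htr]
  refine (lintegral_mono_set hsub).trans ((lintegral_union_le _ _ _).trans (add_le_add ?_ ?_))
  · refine le_trans (le_of_eq ?_) (lintegral_mono_set (inter_subset_right (s := Iio b)))
    refine setLIntegral_congr_fun (measurableSet_Iio.inter measurableSet_Icc) fun s hs => ?_
    simp only [glue_deriv_left _ _ (show s < b from hs.1)]
  · refine (lintegral_union_le _ _ _).trans ?_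
    rw [setLIntegral_measure_zero _ _ (by simp), zero_add]
    refine le_trans (le_of_eq ?_) (lintegral_mono_set Ioc_subset_Icc_self)
    refine setLIntegral_congr_fun measurableSet_Ioc fun s hs => ?_
    simp only [glue_deriv_right _ _ (show b < s from hs.1)]

lemma ccEDist_triangle (p q r : JetSpace k) : ccEDist p r ≤ ccEDist p q + ccEDist q r := by
  refine ENNReal.le_of_forall_pos_le_add fun ε hε hfin => ?_
  have h1 : ccEDist p q ≠ ∞ := fun h => by simp [h] at hfin
  have h2 : ccEDist q r ≠ ∞ := fun h => by simp [h] at hfin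
  have hε' : ((ε / 2 : ℝ≥0) : ℝ≥0∞) ≠ 0 := by
    simp [hε.ne']
  obtain ⟨γ₁, a, b, hab, hH₁, ha, hb, hl₁⟩ := exists_of_ccEDist_lt (ENNReal.lt_add_right h1 hε')
  obtain ⟨γ₂, c, d, hcd, hH₂, hc, hd, hl₂⟩ := exists_of_ccEDist_lt (ENNReal.lt_add_right h2 hε')
  calc ccEDist p r ≤ length γ₁ a b + length γ₂ c d :=
        ccEDist_triangle_aux hab hH₁ ha hb hcd hH₂ hc hd
    _ ≤ (ccEDist p q + (ε / 2 : ℝ≥0)) + (ccEDist q r + (ε / 2 : ℝ≥0)) := add_le_add hl₁.le hl₂.le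
    _ = ccEDist p q + ccEDist q r + ((ε / 2 : ℝ≥0) + (ε / 2 : ℝ≥0)) := by ring
    _ = ccEDist p q + ccEDist q r + ε := by
        rw [← ENNReal.coe_add, add_halves]

lemma ac_enorm_sub_le {f : ℝ → ℝ} {a b s : ℝ} (hf : AbsolutelyContinuousOnInterval f a b)
    (hs : s ∈ Icc a b) : ‖f s - f a‖ₑ ≤ ∫⁻ r in Icc a b, ‖deriv f r‖ₑ := by
  have h1 : AbsolutelyContinuousOnInterval f a s := hf.mono (by
    rw [uIcc_of_le hs.1, uIcc_of_le (hs.1.trans hs.2)]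
    exact Icc_subset_Icc le_rfl hs.2)
  rw [← h1.integral_deriv_eq_sub, intervalIntegral.integral_of_le hs.1]
  refine (enorm_integral_le_lintegral_enorm _).trans (lintegral_mono_set ?_)
  exact Ioc_subset_Icc_self.trans (Icc_subset_Icc le_rfl hs.2)

lemma lintegral_deriv_x_le (γ : ℝ → JetSpace k) (a b : ℝ) :
    ∫⁻ r in Icc a b, ‖deriv (fun s => (γ s).x) r‖ₑ ≤ length γ a b := by
  refine lintegral_mono fun r => ?_
  rw [Real.enorm_eq_ofReal_abs]
  exact ENNReal.ofReal_le_ofReal (Real.abs_le_sqrt 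
    (le_add_of_nonneg_right (sq_nonneg _)))

lemma lintegral_deriv_last_le (γ : ℝ → JetSpace k) (a b : ℝ) :
    ∫⁻ r in Icc a b, ‖deriv (fun s => (γ s).u (Fin.last k)) r‖ₑ ≤ length γ a b := by
  refine lintegral_mono fun r => ?_
  rw [Real.enorm_eq_ofReal_abs]
  exact ENNReal.ofReal_le_ofReal (Real.abs_le_sqrt 
    (le_add_of_nonneg_left (sq_nonneg _)))

lemma coord_bound (p : JetSpace k) (j : Fin (k + 1)) : ∃ C : ℝ≥0, ∀ (γ : ℝ → JetSpace k) (a b : ℝ),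
    IsHorizontal γ a b → γ a = p → length γ a b ≤ 1 → ∀ s ∈ Icc a b,
      ‖(γ s).u j - p.u j‖ₑ ≤ C * length γ a b := by
  induction j using Fin.reverseInduction with
  | last =>
    refine ⟨1, fun γ a b h ha _ s hs => ?_⟩
    rw [← ha, ENNReal.coe_one, one_mul]
    exact (ac_enorm_sub_le (h.ac_u _) hs).trans (lintegral_deriv_last_le γ a b)
  | cast j ih =>
    obtain ⟨C, hC⟩ := ih
    refine ⟨C + ‖p.u j.succ‖₊, fun γ a b h ha hl s hs => ?_⟩
    have hb : ∀ r ∈ Icc a b, ‖(γ r).u j.succ‖ₑ ≤ ((C + ‖p.u j.succ‖₊ : ℝ≥0) : ℝ≥0∞) := by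
      intro r hr
      calc ‖(γ r).u j.succ‖ₑ = ‖((γ r).u j.succ - p.u j.succ) + p.u j.succ‖ₑ := by
            rw [sub_add_cancel]
        _ ≤ ‖(γ r).u j.succ - p.u j.succ‖ₑ + ‖p.u j.succ‖ₑ := enorm_add_le _ _
        _ ≤ C * 1 + ‖p.u j.succ‖ₑ := by
            gcongr
            exact (hC γ a b h ha hl r hr).trans (by gcongr)
        _ = _ := by
            rw [mul_one, ENNReal.coe_add, enorm_eq_nnnorm]
    rw [← ha]
    refine (ac_enorm_sub_le (h.ac_u _) hs).trans ?_
    rw [ha]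
    calc ∫⁻ r in Icc a b, ‖deriv (fun s => (γ s).u j.castSucc) r‖ₑ
        ≤ ∫⁻ r in Icc a b, ((C + ‖p.u j.succ‖₊ : ℝ≥0) : ℝ≥0∞) *
            ‖deriv (fun s => (γ s).x) r‖ₑ := by
          refine setLIntegral_mono_ae (by fun_prop) ?_
          filter_upwards [h.contact] with r hr hmem
          rw [hr hmem j, enorm_mul]
          gcongr
          exact hb r hmem
      _ = ((C + ‖p.u j.succ‖₊ : ℝ≥0) : ℝ≥0∞) * ∫⁻ r in Icc a b, ‖deriv (fun s => (γ s).x) r‖ₑ :=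
          lintegral_const_mul' _ _ ENNReal.coe_ne_top
      _ ≤ _ := by
          gcongr
          exact lintegral_deriv_x_le γ a b

lemma eq_of_ccEDist_eq_zero {p q : JetSpace k} (h : ccEDist p q = 0) : p = q := by
  have key : ∀ (α β : ℝ) (C : ℝ≥0), (∀ (γ : ℝ → JetSpace k) (a b : ℝ), a ≤ b →
      IsHorizontal γ a b → γ a = p → γ b = q → length γ a b ≤ 1 →
      ‖β - α‖ₑ ≤ C * length γ a b) → α = β := by
    intro α β C H
    have h0 : ‖β - α‖ₑ = 0 := by
      refine le_antisymm (ENNReal.le_of_forall_pos_le_add fun ε hε _ => ?_) bot_le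
      have hpos : (0 : ℝ≥0) < min 1 (ε / (C + 1)) := lt_min one_pos (by positivity)
      obtain ⟨γ, a, b, hab, hH, ha, hb, hl⟩ := exists_of_ccEDist_lt (p := p) (q := q)
        (c := ((min 1 (ε / (C + 1)) : ℝ≥0) : ℝ≥0∞)) (by rw [h]; exact_mod_cast hpos)
      have hl1 : length γ a b ≤ 1 := hl.le.trans (by exact_mod_cast min_le_left _ _)
      have hl2 : length γ a b ≤ ((ε / (C + 1) : ℝ≥0) : ℝ≥0∞) :=
        hl.le.trans (by exact_mod_cast min_le_right _ _)
      refine (H γ a b hab hH ha hb hl1).trans ?_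
      rw [zero_add]
      calc (C : ℝ≥0∞) * length γ a b ≤ C * ((ε / (C + 1) : ℝ≥0) : ℝ≥0∞) := by gcongr
        _ = ((C * (ε / (C + 1)) : ℝ≥0) : ℝ≥0∞) := by rw [ENNReal.coe_mul]
        _ ≤ ε := by
          rw [ENNReal.coe_le_coe, mul_div_assoc', div_le_iff₀ (by positivity)]
          rw [mul_comm]
          gcongr
          exact le_self_add
    have := enorm_eq_zero.1 h0
    linarith
  ext j
  · refine key _ _ 1 fun γ a b hab hH ha hb _ => ?_
    rw [← ha, ← hb, ENNReal.coe_one, one_mul]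
    exact (ac_enorm_sub_le hH.ac_x ⟨hab, le_rfl⟩).trans (lintegral_deriv_x_le γ a b)
  · obtain ⟨C, hC⟩ := coord_bound p j
    refine key _ _ C fun γ a b hab hH ha hb hl => ?_
    rw [← hb]
    exact hC γ a b hH ha hl b ⟨hab, le_rfl⟩

/-- `J^k(ℝ)` with the Carnot–Carathéodory distance. -/
noncomputable instance : EMetricSpace (JetSpace k) where
  edist := ccEDist
  edist_self := ccEDist_self
  edist_comm := ccEDist_comm
  edist_triangle := ccEDist_triangle
  eq_of_edist_eq_zero := eq_of_ccEDist_eq_zero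

/-- The Borel σ-algebra of `J^k(ℝ)`. -/
noncomputable instance : MeasurableSpace (JetSpace k) := borel (JetSpace k)

instance : BorelSpace (JetSpace k) := ⟨rfl⟩

/-! ### Jets of functions and the vertical mappings -/

/-- The `k`-jet `j^k_x(f) = (x, f^(k)(x), …, f'(x), f(x))`. -/
noncomputable def jet (k : ℕ) (f : ℝ → ℝ) (x : ℝ) : JetSpace k where
  x := x
  u := fun j => iteratedDeriv j f x

/-- The vertical mapping `V_{f,t}(p) = p ⊙ j^k_{x-t}(f)⁻¹`, where `x` is the base point of `p`;
its values lie in the plane `{x = t}`. -/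
noncomputable def verticalMap (f : ℝ → ℝ) (t : ℝ) (p : JetSpace k) : JetSpace k :=
  p * (jet k f (p.x - t))⁻¹

end JetSpace

/-! The set `E` is a union of two pieces, one carrying the dimension of `E`, the other the dimension
of its image. Let `g(y) = (y - t)^(k+1)/(k+1)!`. Take compact sets `A` of dimension `μ` and `B' ⊆
[t+1, t+2]` of dimension `β/(k+1) ≤ μ`, and let `E` be the jet of the zero function over `A`
together with the jet of `g` over `B'`.

A jet `x ↦ j^k_x(F)` with `F^(k+1)` bounded is a Lipschitz curve, and the base point is a Lipschitz
inverse, so dimensions are preserved (`dimH_image_jet`) and `dim E = max(μ, β/(k+1)) = μ`.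

Since `f` has degree at most `k`, `V_{f,t}` sends `j^k_x(P)`, for a polynomial `P` of degree at most
`k`, to `j^k_t(P - f(· - t))`, whatever `x` is (`verticalMap_jet`). The first piece therefore
collapses to at most one point. On the second piece `j^k_x(g)` is the jet at `x` of the Taylor
polynomial `Q_x(y) = g(y) - (y - x)^(k+1)/(k+1)!`, so its image is `j^k_t(Q_x - f(· - t))`, which
moves with `x`.

This last map is a snowflake: it changes distances from `|x - x'|` to about `|x - x'|^(1/(k+1))`.
The lower bound comes from `u_0`, whose variation between two points of a vertical plane is at most
the distance to the power `k+1` (`edist_u_zero_le`). The upper bound comes from an explicit path at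
scale `ε = |x - x'|^(1/(k+1))` (`exists_edist_jet_jet_le`). The dimension is thus multiplied by
`k+1` and becomes `β`. -/

/-! ### Self-similar Cantor sets of prescribed dimension in the line -/

section CantorSets

open Filter Topology

/-- The point of the Cantor set of ratio `r` with the address `v`. -/
noncomputable def cantorPoint (r : ℝ) (v : ℕ → Fin 2) : ℝ := ∑' n, (v n : ℝ) * ((1 - r) * r ^ n)

lemma hasSum_ratio {r : ℝ} (h0 : 0 ≤ r) (h1 : r < 1) : HasSum (fun n => (1 - r) * r ^ n) 1 := by
  have := (hasSum_geometric_of_lt_one h0 h1).mul_left (1 - r)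
  rwa [mul_inv_cancel₀ (by linarith)] at this

lemma abs_tsum_digit_le {r : ℝ} (h0 : 0 ≤ r) (h1 : r < 1) {δ : ℕ → ℝ} (hδ : ∀ n, |δ n| ≤ 1) (n : ℕ) :
    |∑' i, δ (i + n) * ((1 - r) * r ^ (i + n))| ≤ r ^ n := by
  have h2 : HasSum (fun i => (1 - r) * r ^ (i + n)) (r ^ n) := by
    have := (hasSum_ratio h0 h1).mul_left (r ^ n)
    rw [mul_one] at this
    refine this.congr_fun fun i => ?_
    ring
  refine tsum_of_norm_bounded (f := fun i => δ (i + n) * ((1 - r) * r ^ (i + n))) h2 fun i => ?_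
  have h3 : 0 ≤ (1 - r) * r ^ (i + n) := mul_nonneg (by linarith) (by positivity)
  rw [Real.norm_eq_abs, abs_mul, abs_of_nonneg h3]
  exact mul_le_of_le_one_left h3 (hδ _)

lemma summable_digit {r : ℝ} (h0 : 0 ≤ r) (h1 : r < 1) {δ : ℕ → ℝ} (hδ : ∀ n, |δ n| ≤ 1) :
    Summable fun i => δ i * ((1 - r) * r ^ i) := by
  refine Summable.of_norm_bounded (hasSum_ratio h0 h1).summable fun i => ?_
  have h3 : 0 ≤ (1 - r) * r ^ i := mul_nonneg (by linarith) (by positivity)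
  rw [Real.norm_eq_abs, abs_mul, abs_of_nonneg h3]
  exact mul_le_of_le_one_left h3 (hδ _)

lemma fin_two_cast_mem (a : Fin 2) : (0 : ℝ) ≤ (a : ℝ) ∧ (a : ℝ) ≤ 1 := by
  fin_cases a <;> simp

lemma abs_digit_le (a : Fin 2) : |(a : ℝ)| ≤ 1 := by
  fin_cases a <;> simp

lemma abs_digit_sub_le (a b : Fin 2) : |(a : ℝ) - b| ≤ 1 := by
  fin_cases a <;> fin_cases b <;> simp

lemma abs_digit_sub_eq {a b : Fin 2} (h : a ≠ b) : |(a : ℝ) - b| = 1 := by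
  fin_cases a <;> fin_cases b <;> simp_all

lemma cantorPoint_sub {r : ℝ} (h0 : 0 ≤ r) (h1 : r < 1) (v w : ℕ → Fin 2) :
    cantorPoint r v - cantorPoint r w = ∑' i, ((v i : ℝ) - w i) * ((1 - r) * r ^ i) := by
  rw [cantorPoint, cantorPoint, ← (summable_digit h0 h1 fun n => abs_digit_le (v n)).tsum_sub
    (summable_digit h0 h1 fun n => abs_digit_le (w n))]
  exact tsum_congr fun i => by ring

lemma abs_cantorPoint_sub_le {r : ℝ} (h0 : 0 ≤ r) (h1 : r < 1) {v w : ℕ → Fin 2} {n : ℕ}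
    (h : ∀ i < n, v i = w i) : |cantorPoint r v - cantorPoint r w| ≤ r ^ n := by
  rw [cantorPoint_sub h0 h1, ← (summable_digit h0 h1
    fun i => abs_digit_sub_le (v i) (w i)).sum_add_tsum_nat_add n, Finset.sum_eq_zero, zero_add]
  · exact abs_tsum_digit_le h0 h1 (fun i => abs_digit_sub_le (v i) (w i)) n
  · intro i hi
    rw [h i (Finset.mem_range.1 hi)]
    simp

/-- The first differing digit contributes `(1 - r) r^n`, and all later digits together at most
`r^(n+1)`. -/
lemma le_abs_cantorPoint_sub {r : ℝ} (h0 : 0 ≤ r) (h1 : r < 1) {v w : ℕ → Fin 2} {n : ℕ}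
    (h : ∀ i < n, v i = w i) (hn : v n ≠ w n) :
    (1 - 2 * r) * r ^ n ≤ |cantorPoint r v - cantorPoint r w| := by
  rw [cantorPoint_sub h0 h1, ← (summable_digit h0 h1
    fun i => abs_digit_sub_le (v i) (w i)).sum_add_tsum_nat_add (n + 1), Finset.sum_range_succ,
    Finset.sum_eq_zero, zero_add]
  · have h2 := abs_tsum_digit_le h0 h1 (fun i => abs_digit_sub_le (v i) (w i)) (n + 1)
    have h3 : 0 ≤ (1 - r) * r ^ n := mul_nonneg (by linarith) (by positivity)
    have h4 : |((v n : ℝ) - w n) * ((1 - r) * r ^ n)| = (1 - r) * r ^ n := by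
      rw [abs_mul, abs_digit_sub_eq hn, one_mul, abs_of_nonneg h3]
    have h5 := abs_sub_abs_le_abs_add (((v n : ℝ) - w n) * ((1 - r) * r ^ n))
      (∑' i, ((v (i + (n + 1)) : ℝ) - w (i + (n + 1))) * ((1 - r) * r ^ (i + (n + 1))))
    rw [h4] at h5
    rw [pow_succ] at h2
    linarith
  · intro i hi
    rw [h i (Finset.mem_range.1 hi)]
    simp

lemma cantorPoint_mem_Icc {r : ℝ} (h0 : 0 ≤ r) (h1 : r < 1) (v : ℕ → Fin 2) :
    cantorPoint r v ∈ Icc (0 : ℝ) 1 := by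
  have h3 : ∀ n, 0 ≤ (1 - r) * r ^ n := fun n => mul_nonneg (by linarith) (by positivity)
  refine ⟨tsum_nonneg fun n => mul_nonneg (fin_two_cast_mem _).1 (h3 n), ?_⟩
  rw [← (hasSum_ratio h0 h1).tsum_eq]
  exact (summable_digit h0 h1 fun n => abs_digit_le (v n)).tsum_mono
    (hasSum_ratio h0 h1).summable fun n => mul_le_of_le_one_left (h3 n) (fin_two_cast_mem _).2

lemma continuous_cantorPoint {r : ℝ} (h0 : 0 ≤ r) (h1 : r < 1) : Continuous (cantorPoint r) := by
  refine continuous_tsum (u := fun n => (1 - r) * r ^ n) (fun n => ?_)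
    (hasSum_ratio h0 h1).summable fun n v => ?_
  · have : Continuous fun a : Fin 2 => (a : ℝ) := continuous_of_discreteTopology
    fun_prop
  · have h3 : 0 ≤ (1 - r) * r ^ n := mul_nonneg (by linarith) (by positivity)
    rw [Real.norm_eq_abs, abs_mul, abs_of_nonneg h3]
    exact mul_le_of_le_one_left h3 (abs_digit_le _)

/-- The `2^n` cylinders of level `n` have diameter at most `r^n`, and `2^n (r^n)^s = 1`, so the
`s`-dimensional measure is at most `1`. -/
lemma dimH_range_cantorPoint_le {r : ℝ} (h0 : 0 < r) (h1 : r < 1) {s : ℝ≥0}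
    (hs : r ^ (s : ℝ) = 1 / 2) : dimH (range (cantorPoint r)) ≤ s := by
  have hdiam : ∀ (n : ℕ) (a : Fin n → Fin 2),
      Metric.ediam (cantorPoint r '' {v | ∀ i : Fin n, v i = a i}) ≤ ENNReal.ofReal (r ^ n) := by
    refine fun n a => Metric.ediam_le fun x hx y hy => ?_
    obtain ⟨v, hv, rfl⟩ := hx
    obtain ⟨w, hw, rfl⟩ := hy
    rw [edist_dist, Real.dist_eq]
    refine ENNReal.ofReal_le_ofReal (abs_cantorPoint_sub_le h0.le h1 fun i hi => ?_)
    exact (hv ⟨i, hi⟩).trans (hw ⟨i, hi⟩).symm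
  refine dimH_le_of_hausdorffMeasure_ne_top (ne_top_of_le_ne_top ENNReal.one_ne_top ?_)
  refine (Measure.hausdorffMeasure_le_liminf_sum (ι := fun n => Fin n → Fin 2) (l := atTop) (s : ℝ)
    (range (cantorPoint r)) (fun n => ENNReal.ofReal (r ^ n)) ?_
    (fun n a => cantorPoint r '' {v | ∀ i : Fin n, v i = a i}) ?_ ?_).trans ?_
  · have := ENNReal.tendsto_ofReal (tendsto_pow_atTop_nhds_zero_of_lt_one h0.le h1)
    rwa [ENNReal.ofReal_zero] at this
  · exact Eventually.of_forall hdiam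
  · refine Eventually.of_forall fun n x hx => ?_
    obtain ⟨v, rfl⟩ := hx
    exact mem_iUnion.2 ⟨fun i => v i, v, fun i => rfl, rfl⟩
  · refine (liminf_le_liminf (v := fun _ => (1 : ℝ≥0∞)) (Eventually.of_forall fun n => ?_)).trans
      (by simp)
    have hn : ∀ a : Fin n → Fin 2,
        Metric.ediam (cantorPoint r '' {v | ∀ i : Fin n, v i = a i}) ^ (s : ℝ) ≤
          ENNReal.ofReal ((1 / 2) ^ n) := by
      intro a
      rw [← hs, ← Real.rpow_natCast, ← Real.rpow_mul h0.le, mul_comm, Real.rpow_mul h0.le,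
        Real.rpow_natCast, ← ENNReal.ofReal_rpow_of_nonneg (by positivity) s.coe_nonneg]
      exact ENNReal.rpow_le_rpow (hdiam n a) s.2
    refine (Finset.sum_le_sum fun a _ => hn a).trans ?_
    rw [Finset.sum_const, nsmul_eq_mul, ← ENNReal.ofReal_natCast,
      ← ENNReal.ofReal_mul (by positivity), ← ENNReal.ofReal_one]
    refine ENNReal.ofReal_le_ofReal (le_of_eq ?_)
    simp

/-- Reading an address as a binary expansion maps the Cantor set onto `[0, 1]`. This map is
`s`-Hölder: points whose addresses first differ at place `n` are at least `(1 - 2r) r^n` apart, and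
their images at most `2^(-n) = (r^n)^s`. -/
lemma le_dimH_range_cantorPoint {r : ℝ} (h0 : 0 < r) (h1 : r < 1 / 2) {s : ℝ≥0} (hs0 : 0 < s)
    (hs : r ^ (s : ℝ) = 1 / 2) : s ≤ dimH (range (cantorPoint r)) := by
  have hpos : 0 < 1 - 2 * r := by linarith
  have hr1 : r < 1 := by linarith
  have key : ∀ v w, |Real.ofDigits v - Real.ofDigits w| ≤
      ((1 - 2 * r)⁻¹) ^ (s : ℝ) * |cantorPoint r v - cantorPoint r w| ^ (s : ℝ) := by
    intro v w
    by_cases hvw : v = w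
    · rw [hvw, sub_self, abs_zero]
      positivity
    · have hex : ∃ n, v n ≠ w n := Function.ne_iff.1 hvw
      classical
      have hlt : ∀ i < Nat.find hex, v i = w i := fun i hi => not_not.1 (Nat.find_min hex hi)
      refine (Real.abs_ofDigits_sub_ofDigits_le hlt).trans ?_
      have h2 := le_abs_cantorPoint_sub h0.le hr1 hlt (Nat.find_spec hex)
      rw [← Real.mul_rpow (by positivity) (by positivity)]
      have h3 : r ^ Nat.find hex ≤ (1 - 2 * r)⁻¹ * |cantorPoint r v - cantorPoint r w| := by
        rw [inv_mul_eq_div, le_div_iff₀ hpos]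
        linarith
      calc (((2 : ℕ) : ℝ) ^ Nat.find hex)⁻¹ = (r ^ Nat.find hex) ^ (s : ℝ) := by
            rw [← Real.rpow_natCast r, ← Real.rpow_mul h0.le, mul_comm, Real.rpow_mul h0.le, hs,
              Real.rpow_natCast]
            simp
        _ ≤ _ := Real.rpow_le_rpow (by positivity) h3 s.2
  have hinj : Function.Injective (cantorPoint r) := by
    intro v w hvw
    by_contra hne
    have hex : ∃ n, v n ≠ w n := Function.ne_iff.1 hne
    classical
    have hlt : ∀ i < Nat.find hex, v i = w i := fun i hi => not_not.1 (Nat.find_min hex hi)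
    have h2 := le_abs_cantorPoint_sub h0.le hr1 hlt (Nat.find_spec hex)
    rw [hvw, sub_self, abs_zero] at h2
    have : 0 < (1 - 2 * r) * r ^ Nat.find hex := by positivity
    linarith
  have hold : HolderOnWith (Real.toNNReal (((1 - 2 * r)⁻¹) ^ (s : ℝ))) s
      (fun x => Real.ofDigits (Function.invFun (cantorPoint r) x)) (range (cantorPoint r)) := by
    rintro _ ⟨v, rfl⟩ _ ⟨w, rfl⟩
    simp only [Function.leftInverse_invFun hinj _]
    rw [edist_dist,
      edist_dist, Real.dist_eq, Real.dist_eq, ENNReal.ofReal_rpow_of_nonneg (abs_nonneg _) s.coe_nonneg,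
      ← ENNReal.ofReal, ← ENNReal.ofReal_mul (by positivity)]
    exact ENNReal.ofReal_le_ofReal (key v w)
  have h3 := hold.dimH_image_le hs0
  have h4 : Icc (0 : ℝ) 1 ⊆
      (fun x => Real.ofDigits (Function.invFun (cantorPoint r) x)) '' range (cantorPoint r) := by
    intro y hy
    obtain ⟨v, -, rfl⟩ := Real.ofDigits_SurjOn (b := 2) (by norm_num) hy
    exact ⟨_, ⟨v, rfl⟩, by simp only [Function.leftInverse_invFun hinj v]⟩
  have h5 : dimH (Icc (0 : ℝ) 1) = 1 := by
    rw [Real.dimH_of_nonempty_interior (by simp)]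
    simp
  have h6 := (dimH_mono h4).trans h3
  rw [h5, ENNReal.le_div_iff_mul_le (by simp [hs0.ne']) (by simp), one_mul] at h6
  exact h6

/-- For every `s ∈ [0, 1]`, the interval `[0, 1]` contains a compact set of Hausdorff dimension
`s`. -/
theorem exists_isCompact_dimH_eq (s : ℝ≥0) (hs : s ≤ 1) :
    ∃ C : Set ℝ, IsCompact C ∧ C ⊆ Icc 0 1 ∧ dimH C = s := by
  -- The extreme dimensions are treated apart: `s = 1` would need `r = 1/2`, where the gaps close,
  -- and no ratio `r > 0` corresponds to `s = 0`.
  rcases eq_or_lt_of_le hs with rfl | hs1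
  · refine ⟨Icc 0 1, isCompact_Icc, subset_rfl, ?_⟩
    rw [Real.dimH_of_nonempty_interior (by simp)]
    simp
  rcases eq_or_lt_of_le (zero_le (a := s)) with rfl | hs0
  · exact ⟨{0}, isCompact_singleton, by simp, by simp⟩
  have hs0' : (0 : ℝ) < s := hs0
  have hs1' : (s : ℝ) < 1 := hs1
  have hr : ((1 / 2 : ℝ) ^ (1 / (s : ℝ))) ^ (s : ℝ) = 1 / 2 := by
    rw [← Real.rpow_mul (by norm_num), one_div_mul_cancel hs0'.ne', Real.rpow_one]
  have h0 : (0 : ℝ) < (1 / 2) ^ (1 / (s : ℝ)) := by positivity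
  have h1 : (1 / 2 : ℝ) ^ (1 / (s : ℝ)) < 1 / 2 := by
    have := Real.rpow_lt_rpow_of_exponent_gt (x := 1 / 2) (by norm_num) (by norm_num)
      ((one_lt_div hs0').2 hs1')
    rwa [Real.rpow_one] at this
  refine ⟨range (cantorPoint ((1 / 2) ^ (1 / (s : ℝ)))), isCompact_range
    (continuous_cantorPoint h0.le (by linarith)), ?_, le_antisymm
    (dimH_range_cantorPoint_le h0 (by linarith) hr) (le_dimH_range_cantorPoint h0 h1 hs0 hr)⟩
  rintro _ ⟨v, rfl⟩
  exact cantorPoint_mem_Icc h0.le (by linarith) v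

end CantorSets

/-! ### Taylor re-expansion along horizontal curves -/

/-- The derivative telescopes: `U_i' = U_{i+1} x'` cancels against the derivative of
`y^(i+1)/(i+1)!`, and only the term with the derivative of the top coefficient survives. -/
lemma HasDerivAt.sum_taylor {U : ℕ → ℝ → ℝ} {y : ℝ → ℝ} {x' d r : ℝ} (n : ℕ)
    (hy : HasDerivAt y (-x') r) (hU : ∀ i < n, HasDerivAt (U i) (U (i + 1) r * x') r)
    (hn : HasDerivAt (U n) d r) :
    HasDerivAt (fun r => ∑ i ∈ Finset.range (n + 1), U i r * (y r ^ i / (i ! : ℝ)))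
      (d * (y r ^ n / (n ! : ℝ))) r := by
  induction n generalizing d with
  | zero => simpa using hn
  | succ n ih =>
    have h1 := ih (fun i hi => hU i (by omega)) (hU n (by omega))
    have h2 := h1.fun_add (hn.fun_mul ((hy.fun_pow (n + 1)).div_const ((n + 1)! : ℝ)))
    simp only [Finset.sum_range_succ _ (n + 1)]
    refine h2.congr_deriv ?_
    have h3 : (n ! : ℝ) ≠ 0 := by positivity
    rw [Nat.factorial_succ]
    push_cast
    field_simp
    ring

namespace AbsolutelyContinuousOnInterval

lemma fun_pow {f : ℝ → ℝ} {a b : ℝ} (hf : AbsolutelyContinuousOnInterval f a b) (n : ℕ) :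
    AbsolutelyContinuousOnInterval (fun s => f s ^ n) a b := by
  induction n with
  | zero => simpa using JetSpace.ac_const 1 a b
  | succ n ih => simpa only [pow_succ] using ih.fun_mul hf

lemma finset_sum {ι : Type*} (S : Finset ι) {f : ι → ℝ → ℝ} {a b : ℝ}
    (hf : ∀ i ∈ S, AbsolutelyContinuousOnInterval (f i) a b) :
    AbsolutelyContinuousOnInterval (fun s => ∑ i ∈ S, f i s) a b := by
  classical
  induction S using Finset.induction_on with
  | empty => simpa using JetSpace.ac_const 0 a b
  | insert i S hi ih =>
    simp only [Finset.sum_insert hi]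
    exact (hf i (by simp)).fun_add (ih fun j hj => hf j (by simp [hj]))

end AbsolutelyContinuousOnInterval

namespace JetSpace

variable {k : ℕ}

/-- Reindexing by `i = j - s`, with the coefficients extended by zero to all natural numbers, puts
`shift` in the form required by `HasDerivAt.sum_taylor`. -/
lemma shift_eq_sum_range (y : ℝ) (u : Fin (k + 1) → ℝ) (s : Fin (k + 1)) :
    shift y u s = ∑ i ∈ Finset.range (k - s + 1),
      (if h : s + i < k + 1 then u ⟨s + i, h⟩ else 0) * (y ^ i / (i ! : ℝ)) := by
  refine Finset.sum_bij (fun j _ => (j : ℕ) - s) ?_ ?_ ?_ ?_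
  · intro j hj
    have h1 : (s : ℕ) ≤ j := by simpa using hj
    simp only [Finset.mem_range]
    omega
  · intro i hi j hj hij
    have h1 : (s : ℕ) ≤ i := by simpa using hi
    have h2 : (s : ℕ) ≤ j := by simpa using hj
    exact Fin.ext (by omega)
  · intro i hi
    have h1 : i < k - s + 1 := by simpa using hi
    exact ⟨⟨s + i, by omega⟩, by simp [Fin.le_def], by simp⟩
  · intro j hj
    have h1 : (s : ℕ) ≤ j := by simpa using hj
    have h2 : (s : ℕ) + (j - s) = j := by omega
    have h3 : (s : ℕ) + (j - s) < k + 1 := by omega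
    rw [dif_pos h3]
    congr 2
    exact Fin.ext h2.symm

lemma hasDerivAt_shift {u : ℝ → Fin (k + 1) → ℝ} {x : ℝ → ℝ} {x' d r : ℝ} (t : ℝ)
    (hx : HasDerivAt x x' r)
    (hu : ∀ j : Fin k, HasDerivAt (fun r => u r j.castSucc) (u r j.succ * x') r)
    (hl : HasDerivAt (fun r => u r (Fin.last k)) d r) (s : Fin (k + 1)) :
    HasDerivAt (fun r => shift (t - x r) (u r) s)
      (d * ((t - x r) ^ (k - (s : ℕ)) / ((k - (s : ℕ))! : ℝ))) r := by
  simp only [shift_eq_sum_range]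
  refine HasDerivAt.sum_taylor
    (U := fun i r => if h : s + i < k + 1 then u r ⟨s + i, h⟩ else 0) _ (hx.const_sub t) ?_ ?_
  · intro i hi
    have h1 : (s : ℕ) + i < k + 1 := by omega
    have h2 : (s : ℕ) + (i + 1) < k + 1 := by omega
    simp only [dif_pos h1, dif_pos h2]
    exact hu ⟨s + i, by omega⟩
  · have h1 : (s : ℕ) + (k - s) < k + 1 := by omega
    have h2 : (⟨s + (k - s), h1⟩ : Fin (k + 1)) = Fin.last k := Fin.ext (by simp; omega)
    simp only [dif_pos h1, h2]
    exact hl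

/-! ### Lower bounds for the Carnot–Carathéodory distance -/

lemma lipschitzWith_x : LipschitzWith 1 (fun p : JetSpace k => p.x) := by
  intro p q
  rw [ENNReal.coe_one, one_mul, edist_comm p.x]
  refine le_of_forall_gt fun c hc => ?_
  obtain ⟨γ, a, b, hab, hH, rfl, rfl, hl⟩ := exists_of_ccEDist_lt hc
  refine lt_of_le_of_lt ?_ hl
  rw [edist_eq_enorm_sub]
  exact (ac_enorm_sub_le hH.ac_x ⟨hab, le_rfl⟩).trans (lintegral_deriv_x_le γ a b)

/-- Evaluate at `x(a)` the polynomial whose `k`-jet is `γ(r)`. By the contact equations its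
derivative in `r` is `u_k' (x(a) - x(r))^k / k!`, where `|x(a) - x(r)|` is at most the length;
integrating `|u_k'|` gives one more factor of the length. -/
lemma IsHorizontal.enorm_sub_le {γ : ℝ → JetSpace k} {a b : ℝ} (hab : a ≤ b)
    (h : IsHorizontal γ a b) (hx : (γ a).x = (γ b).x) :
    ‖(γ b).u 0 - (γ a).u 0‖ₑ ≤ length γ a b ^ (k + 1) := by
  have hac : AbsolutelyContinuousOnInterval
      (fun r => shift ((γ a).x - (γ r).x) (γ r).u 0) a b := by
    refine AbsolutelyContinuousOnInterval.finset_sum _ fun j _ => (h.ac_u j).fun_mul ?_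
    simp only [div_eq_inv_mul]
    exact (((ac_const _ _ _).fun_sub h.ac_x).fun_pow _).const_mul _
  have h1 := ac_enorm_sub_le hac ⟨hab, le_rfl⟩
  -- Both endpoints have base point `x(a)`, so there the evaluated polynomial is just `u_0`.
  rw [← hx, sub_self, shift_zero, shift_zero] at h1
  refine h1.trans ?_
  calc ∫⁻ r in Icc a b, ‖deriv (fun r => shift ((γ a).x - (γ r).x) (γ r).u 0) r‖ₑ
      ≤ ∫⁻ r in Icc a b, ‖deriv (fun r => (γ r).u (Fin.last k)) r‖ₑ * length γ a b ^ k := by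
        refine setLIntegral_mono_ae' measurableSet_Icc ?_
        filter_upwards [h.contact, h.ac_x.ae_differentiableAt,
          ae_all_iff.2 fun j => (h.ac_u j).ae_differentiableAt] with r hc hdx hdu hr
        have hr' : r ∈ uIcc a b := by rwa [uIcc_of_le hab]
        have hd := hasDerivAt_shift (u := fun r => (γ r).u) (γ a).x (hdx hr').hasDerivAt
          (fun j => (hc hr j) ▸ (hdu j.castSucc hr').hasDerivAt)
          (hdu (Fin.last k) hr').hasDerivAt 0
        rw [hd.deriv, enorm_mul]
        gcongr
        rw [Fin.val_zero, Nat.sub_zero, ← mul_one (length γ a b ^ k), div_eq_mul_inv, enorm_mul,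
          enorm_pow]
        gcongr
        · rw [← enorm_neg, neg_sub]
          exact (ac_enorm_sub_le h.ac_x hr).trans (lintegral_deriv_x_le γ a b)
        · rw [Real.enorm_eq_ofReal_abs, ← ENNReal.ofReal_one]
          refine ENNReal.ofReal_le_ofReal ?_
          rw [abs_of_nonneg (by positivity)]
          exact inv_le_one_of_one_le₀ (by exact_mod_cast Nat.factorial_pos k)
    _ = (∫⁻ r in Icc a b, ‖deriv (fun r => (γ r).u (Fin.last k)) r‖ₑ) * length γ a b ^ k :=
        lintegral_mul_const _ (measurable_deriv _).enorm
    _ ≤ length γ a b * length γ a b ^ k := by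
        gcongr
        exact lintegral_deriv_last_le γ a b
    _ = length γ a b ^ (k + 1) := (pow_succ' _ _).symm

/-- On a vertical plane `{x = t}`, the coordinate `u_0` is Hölder continuous of exponent `k + 1`. -/
lemma edist_u_zero_le {p q : JetSpace k} (h : p.x = q.x) :
    edist (p.u 0) (q.u 0) ≤ edist p q ^ ((k : ℝ) + 1) := by
  have hk : (0 : ℝ) < (k : ℝ) + 1 := by positivity
  rw [← ENNReal.rpow_inv_le_iff hk]
  refine le_of_forall_gt fun c hc => ?_
  obtain ⟨γ, a, b, hab, hH, rfl, rfl, hl⟩ := exists_of_ccEDist_lt hc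
  refine lt_of_le_of_lt ?_ hl
  rw [ENNReal.rpow_inv_le_iff hk, edist_comm, edist_eq_enorm_sub]
  have := hH.enorm_sub_le hab h
  rwa [← ENNReal.rpow_natCast, Nat.cast_succ] at this

/-! ### Jets of smooth functions -/

lemma hasDerivAt_iteratedDeriv {F : ℝ → ℝ} {n : ℕ} (hF : ContDiff ℝ n F) {j : ℕ} (hj : j < n)
    (x : ℝ) : HasDerivAt (iteratedDeriv j F) (iteratedDeriv (j + 1) F x) x := by
  rw [iteratedDeriv_succ]
  exact (hF.differentiable_iteratedDeriv j (by exact_mod_cast hj)).differentiableAt.hasDerivAt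

lemma ac_iteratedDeriv {F : ℝ → ℝ} {n : ℕ} (hF : ContDiff ℝ n F) {j : ℕ} (hj : j < n)
    (a b : ℝ) : AbsolutelyContinuousOnInterval (iteratedDeriv j F) a b := by
  obtain ⟨C, hC⟩ := isCompact_uIcc.exists_bound_of_continuousOn (s := uIcc a b)
    (hF.continuous_iteratedDeriv (j + 1) (by exact_mod_cast hj)).continuousOn
  refine LipschitzOnWith.absolutelyContinuousOnInterval (K := C.toNNReal) ?_
  refine (convex_uIcc a b).lipschitzOnWith_of_nnnorm_hasDerivWithin_le
    (fun x _ => (hasDerivAt_iteratedDeriv hF hj x).hasDerivWithinAt) fun x hx => ?_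
  rw [← norm_toNNReal]
  exact Real.toNNReal_le_toNNReal (hC x hx)

lemma isHorizontal_jet {F : ℝ → ℝ} (hF : ContDiff ℝ (k + 1 : ℕ) F) (a b : ℝ) :
    IsHorizontal (jet k F) a b where
  ac_x := (LipschitzWith.id.lipschitzOnWith (s := uIcc a b)).absolutelyContinuousOnInterval
  ac_u j := ac_iteratedDeriv hF j.2 a b
  contact := Filter.Eventually.of_forall fun s _ j => by
    have h1 := (hasDerivAt_iteratedDeriv hF j.castSucc.2 s).deriv
    have h2 : deriv (fun r => (jet k F r).x) s = 1 := deriv_id s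
    rw [h2, mul_one]
    exact h1

lemma edist_jet_le {F : ℝ → ℝ} (hF : ContDiff ℝ (k + 1 : ℕ) F) {a b M : ℝ} (hab : a ≤ b)
    (hM : ∀ y ∈ Icc a b, |iteratedDeriv (k + 1) F y| ≤ M) :
    edist (jet k F a) (jet k F b) ≤ ENNReal.ofReal ((1 + M) * (b - a)) := by
  have hM0 : 0 ≤ M := (abs_nonneg _).trans (hM a ⟨le_rfl, hab⟩)
  refine (ccEDist_le hab (isHorizontal_jet hF a b) rfl rfl).trans ?_
  calc length (jet k F) a b ≤ ∫⁻ _ in Icc a b, ENNReal.ofReal (1 + M) := by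
        refine setLIntegral_mono measurable_const fun s hs => ENNReal.ofReal_le_ofReal ?_
        have h1 : deriv (fun r => (jet k F r).u (Fin.last k)) s = iteratedDeriv (k + 1) F s :=
          (hasDerivAt_iteratedDeriv hF (Fin.last k).2 s).deriv
        have h2 : deriv (fun r => (jet k F r).x) s = 1 := deriv_id s
        rw [h1, h2, Real.sqrt_le_left (by positivity)]
        have h3 := sq_le_sq' (neg_le_of_abs_le (hM s hs)) (le_of_abs_le (hM s hs))
        nlinarith
    _ = ENNReal.ofReal ((1 + M) * (b - a)) := by
        rw [setLIntegral_const, Real.volume_Icc, ← ENNReal.ofReal_mul (by positivity)]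

lemma lipschitzWith_jet {F : ℝ → ℝ} (hF : ContDiff ℝ (k + 1 : ℕ) F) {M : ℝ}
    (hM : ∀ y, |iteratedDeriv (k + 1) F y| ≤ M) :
    LipschitzWith (Real.toNNReal (1 + M)) (jet k F) := by
  have hM0 : 0 ≤ M := (abs_nonneg _).trans (hM 0)
  have key : ∀ a b, a ≤ b →
      edist (jet k F a) (jet k F b) ≤ Real.toNNReal (1 + M) * edist a b := by
    intro a b hab
    refine (edist_jet_le hF hab fun y _ => hM y).trans ?_
    rw [edist_comm, edist_dist, Real.dist_eq, abs_of_nonneg (sub_nonneg.2 hab),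
      ENNReal.ofReal_mul (by positivity)]
    rfl
  intro a b
  rcases le_total a b with h | h
  · exact key a b h
  · rw [edist_comm, edist_comm a]
    exact key b a h

/-- The jet is Lipschitz, and the base point is a 1-Lipschitz left inverse of it. -/
lemma dimH_image_jet {F : ℝ → ℝ} (hF : ContDiff ℝ (k + 1 : ℕ) F) {M : ℝ}
    (hM : ∀ y, |iteratedDeriv (k + 1) F y| ≤ M) (C : Set ℝ) : dimH (jet k F '' C) = dimH C := by
  refine le_antisymm ((lipschitzWith_jet hF hM).dimH_image_le C) ?_
  have h := (lipschitzWith_x (k := k)).dimH_image_le (jet k F '' C)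
  rw [image_image] at h
  simpa [jet] using h

/-! ### Vertical mappings of jets of polynomials -/

/-- The re-expansion at `t` does not depend on the centre `x`: its derivative in `x` contains the
factor `g^(k+1) = 0`. At `x = t` the shift is trivial. -/
lemma shift_jet {g : ℝ → ℝ} (hg : ContDiff ℝ (k + 1 : ℕ) g)
    (hg0 : ∀ y, iteratedDeriv (k + 1) g y = 0) (t x : ℝ) (s : Fin (k + 1)) :
    shift (t - x) (jet k g x).u s = iteratedDeriv s g t := by
  have hd : ∀ x, HasDerivAt (fun x => shift (t - x) (jet k g x).u s) 0 x := by
    intro x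
    have := hasDerivAt_shift (u := fun x => (jet k g x).u) t (hasDerivAt_id x)
      (fun j => by
        rw [mul_one]
        exact hasDerivAt_iteratedDeriv hg j.castSucc.2 x)
      (hasDerivAt_iteratedDeriv hg (Fin.last k).2 x) s
    simpa [hg0] using this
  have h := is_const_of_deriv_eq_zero (fun x => (hd x).differentiableAt)
    (fun x => (hd x).deriv) x t
  simp only [sub_self, shift_zero] at h
  exact h

lemma verticalMap_jet {f g : ℝ → ℝ} (hf : ContDiff ℝ (k + 1 : ℕ) f)
    (hf0 : ∀ y, iteratedDeriv (k + 1) f y = 0) (hg : ContDiff ℝ (k + 1 : ℕ) g)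
    (hg0 : ∀ y, iteratedDeriv (k + 1) g y = 0) (t x : ℝ) :
    verticalMap f t (jet k g x) = jet k (fun y => g y - f (y - t)) t := by
  ext s
  · simp [verticalMap, jet]
  · have h1 := shift_jet hf hf0 0 (x - t) s
    have h2 := shift_jet hg hg0 t x s
    have hs : ((s : ℕ) : WithTop ℕ∞) ≤ ((k + 1 : ℕ) : WithTop ℕ∞) := by exact_mod_cast s.2.le
    have hft : ContDiff ℝ (s : ℕ) (fun y => f (y - t)) :=
      (hf.of_le hs).comp (contDiff_id.sub contDiff_const)
    rw [verticalMap, mul_u, inv_u, inv_x]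
    change -shift (-(x - t)) (jet k f (x - t)).u s + shift (-(x - t)) (jet k g x).u s =
      iteratedDeriv s (fun y => g y - f (y - t)) t
    rw [neg_sub, h2, ← neg_sub x t, ← zero_sub (x - t), h1, iteratedDeriv_fun_sub
      (hg.of_le hs).contDiffAt hft.contDiffAt]
    simp [iteratedDeriv_comp_sub_const]
    ring

end JetSpace

/-! ### Taylor monomials and cutoff functions -/

/-- The monomial `(y - c)^n / n!`. -/
noncomputable def taylorMonomial (c : ℝ) (n : ℕ) (y : ℝ) : ℝ := (y - c) ^ n / (n ! : ℝ)

lemma contDiff_taylorMonomial (c : ℝ) (n : ℕ) {m : WithTop ℕ∞} :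
    ContDiff ℝ m (taylorMonomial c n) := by
  unfold taylorMonomial
  fun_prop

lemma deriv_taylorMonomial (c : ℝ) (n : ℕ) :
    deriv (taylorMonomial c (n + 1)) = taylorMonomial c n := by
  funext y
  have h : HasDerivAt (taylorMonomial c (n + 1))
      ((n + 1 : ℕ) * (y - c) ^ n * 1 / ((n + 1)! : ℝ)) y :=
    (((hasDerivAt_id y).sub_const c).pow (n + 1)).div_const _
  have h3 : (n ! : ℝ) ≠ 0 := by positivity
  rw [h.deriv, taylorMonomial, Nat.factorial_succ]
  push_cast
  field_simp

lemma iteratedDeriv_taylorMonomial (c : ℝ) {j n : ℕ} (h : j ≤ n) :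
    iteratedDeriv j (taylorMonomial c n) = taylorMonomial c (n - j) := by
  induction j with
  | zero => simp
  | succ j ih =>
    rw [iteratedDeriv_succ, ih (by omega), show n - j = n - (j + 1) + 1 by omega,
      deriv_taylorMonomial]

lemma taylorMonomial_zero (c y : ℝ) : taylorMonomial c 0 y = 1 := by
  simp [taylorMonomial]

lemma taylorMonomial_self (c : ℝ) {n : ℕ} (hn : n ≠ 0) : taylorMonomial c n c = 0 := by
  simp [taylorMonomial, hn]

/-- The constant is uniform in `n ≤ N`, so that it serves all derivatives of a monomial of degree
`N` at once. -/
lemma abs_taylorMonomial_sub_le {c c' y : ℝ} (hc : |y - c| ≤ 2) (hc' : |y - c'| ≤ 2) {n N : ℕ}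
    (h : n ≤ N) :
    |taylorMonomial c n y - taylorMonomial c' n y| ≤ N * 2 ^ N * |c - c'| := by
  have h1 : (1 : ℝ) ≤ (n ! : ℝ) := by exact_mod_cast Nat.factorial_pos n
  have h2 := abs_pow_sub_pow_le (y - c) (y - c') n
  rw [taylorMonomial, taylorMonomial, ← sub_div, abs_div, abs_of_pos (by linarith : (0 : ℝ) < n !)]
  refine (div_le_self (abs_nonneg _) h1).trans (h2.trans ?_)
  have h4 : max |y - c| |y - c'| ^ (n - 1) ≤ 2 ^ N :=
    (pow_le_pow_left₀ (by positivity) (max_le hc hc') _).trans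
      (pow_le_pow_right₀ (by norm_num) (by omega))
  have h5 : |y - c - (y - c')| = |c - c'| := by
    rw [abs_sub_comm c]
    congr 1
    ring
  have h6 : (n : ℝ) ≤ N := by exact_mod_cast h
  rw [h5]
  calc |c - c'| * n * max |y - c| |y - c'| ^ (n - 1) ≤ |c - c'| * N * 2 ^ N := by gcongr
    _ = _ := by ring

/-- Smooth transitions from `0` near `t` to `1` near `t + ε`, with controlled derivatives. -/
lemma exists_cutoff (n : ℕ) : ∃ B : ℝ, 0 ≤ B ∧ ∀ t ε : ℝ, 0 < ε → ε ≤ 1 → ∃ χ : ℝ → ℝ,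
    ContDiff ℝ n χ ∧ (χ =ᶠ[nhds t] fun _ => 0) ∧ (χ =ᶠ[nhds (t + ε)] fun _ => 1) ∧
      ∀ i ≤ n, ∀ y ∈ Icc t (t + ε), |iteratedDeriv i χ y| ≤ B / ε ^ n := by
  -- The factor `3x - 1` makes `ψ` constant on `x ≤ 1/3` and on `x ≥ 2/3`, hence near both
  -- endpoints, where whole jets have to agree.
  set ψ : ℝ → ℝ := fun x => Real.smoothTransition (3 * x - 1) with hψ
  have hψc : ContDiff ℝ n ψ :=
    (Real.smoothTransition.contDiff (n := (n : ℕ∞))).comp (by fun_prop)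
  have hB : ∀ i : ℕ, ∃ B : ℝ, 0 ≤ B ∧ (i ≤ n → ∀ x ∈ Icc (0 : ℝ) 1, |iteratedDeriv i ψ x| ≤ B) := by
    intro i
    by_cases hi : i ≤ n
    · obtain ⟨B, hB⟩ := isCompact_Icc.exists_bound_of_continuousOn (s := Icc (0 : ℝ) 1)
        (hψc.continuous_iteratedDeriv i (by exact_mod_cast hi)).continuousOn
      exact ⟨B, (norm_nonneg _).trans (hB 0 (by simp)), fun _ => hB⟩
    · exact ⟨0, le_rfl, fun h => absurd h hi⟩
  choose B hB0 hB using hB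
  refine ⟨∑ i ∈ Finset.range (n + 1), B i, Finset.sum_nonneg fun i _ => hB0 i,
    fun t ε hε hε1 => ⟨fun y => ψ (ε⁻¹ * (y - t)), hψc.comp (by fun_prop), ?_, ?_, ?_⟩⟩
  · filter_upwards [Iio_mem_nhds (show t < t + ε / 3 by linarith)] with y hy
    refine Real.smoothTransition.zero_of_nonpos ?_
    have h1 : y < t + ε / 3 := hy
    have h2 : ε⁻¹ * (y - t) ≤ 1 / 3 := by
      rw [inv_mul_le_iff₀ hε]
      linarith
    linarith
  · filter_upwards [Ioi_mem_nhds (show t + 2 * ε / 3 < t + ε by linarith)] with y hy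
    refine Real.smoothTransition.one_of_one_le ?_
    have h1 : t + 2 * ε / 3 < y := hy
    have h2 : 2 / 3 ≤ ε⁻¹ * (y - t) := by
      rw [le_inv_mul_iff₀ hε]
      linarith
    linarith
  · intro i hi y hy
    have h1 : iteratedDeriv i (fun y => ψ (ε⁻¹ * (y - t))) y =
        ε⁻¹ ^ i * iteratedDeriv i ψ (ε⁻¹ * (y - t)) := by
      rw [iteratedDeriv_comp_sub_const i (fun z => ψ (ε⁻¹ * z)) t, iteratedDeriv_comp_const_mul
        (hψc.of_le (by exact_mod_cast hi))]
    have h2 : ε⁻¹ * (y - t) ∈ Icc (0 : ℝ) 1 := by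
      refine ⟨mul_nonneg (by positivity) (by linarith [hy.1]), ?_⟩
      rw [inv_mul_le_iff₀ hε]
      linarith [hy.2]
    have h3 : B i ≤ ∑ i ∈ Finset.range (n + 1), B i :=
      Finset.single_le_sum (fun i _ => hB0 i) (Finset.mem_range.2 (by omega))
    -- As `ε ≤ 1`, the factor `ε^(-i)` from scaling is at most `ε^(-n)`.
    rw [h1, abs_mul, abs_of_nonneg (by positivity), div_eq_inv_mul, ← inv_pow]
    exact mul_le_mul (pow_le_pow_right₀ ((one_le_inv₀ hε).2 hε1) hi) ((hB i hi _ h2).trans h3)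
      (abs_nonneg _) (by positivity)

/-! ### Upper bound for the distance between jets over the same point -/

namespace JetSpace

variable {k : ℕ}

lemma jet_congr {F G : ℝ → ℝ} {x : ℝ} (h : F =ᶠ[nhds x] G) : jet k F x = jet k G x := by
  ext s
  · rfl
  · exact h.iteratedDeriv_eq s

/-- An upper bound for the distance between two jets at `t` of polynomials of degree at most `k`:
one travels along the jet of one polynomial from `t` to `t + ε`, and back along the jet of an
interpolation between the two. -/
lemma exists_edist_jet_jet_le (k : ℕ) : ∃ M : ℝ, 0 ≤ M ∧ ∀ (F G : ℝ → ℝ) (t ε A : ℝ),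
    ContDiff ℝ (k + 1 : ℕ) F → ContDiff ℝ (k + 1 : ℕ) G →
    (∀ y, iteratedDeriv (k + 1) F y = 0) → (∀ y, iteratedDeriv (k + 1) G y = 0) →
    0 < ε → ε ≤ 1 →
    (∀ i ≤ k + 1, ∀ y ∈ Icc t (t + 1),
      |iteratedDeriv i (fun y => F y - G y) y| ≤ A * ε ^ (k + 1)) →
    edist (jet k F t) (jet k G t) ≤ ENNReal.ofReal ((2 + M * A) * ε) := by
  obtain ⟨B, hB0, hB⟩ := exists_cutoff (k + 1)
  refine ⟨2 ^ (k + 1) * B, by positivity, fun F G t ε A hF hG hF0 hG0 hε hε1 hA => ?_⟩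
  obtain ⟨χ, hχ, hχ0, hχ1, hχB⟩ := hB t ε hε hε1
  have hD : ContDiff ℝ (k + 1 : ℕ) (fun y => F y - G y) := hF.sub hG
  have hχD : ContDiff ℝ (k + 1 : ℕ) (fun y => χ y * (F y - G y)) := hχ.mul hD
  -- `H` has the jet of `G` at `t` and the jet of `F` at `t + ε`.
  set H : ℝ → ℝ := fun y => G y + χ y * (F y - G y) with hH
  have hHc : ContDiff ℝ (k + 1 : ℕ) H := hG.add hχD
  have h0 : jet k H t = jet k G t := jet_congr <| by
    filter_upwards [hχ0] with y hy
    simp [hH, hy]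
  have h1 : jet k H (t + ε) = jet k F (t + ε) := jet_congr <| by
    filter_upwards [hχ1] with y hy
    simp [hH, hy]
  -- In the Leibniz formula the loss `ε^(-(k+1))` from the cutoff is compensated by the size `A
  -- ε^(k+1)` of the derivatives of `F - G`; the binomial coefficients add up to `2^(k+1)`.
  have hbound : ∀ y ∈ Icc t (t + ε), |iteratedDeriv (k + 1) H y| ≤ 2 ^ (k + 1) * B * A := by
    intro y hy
    have hA0 : 0 ≤ A * ε ^ (k + 1) := (abs_nonneg _).trans (hA 0 (by omega) t (by simp))
    rw [hH, iteratedDeriv_fun_add hG.contDiffAt hχD.contDiffAt, hG0, zero_add,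
      iteratedDeriv_fun_mul hχ.contDiffAt hD.contDiffAt]
    refine (Finset.abs_sum_le_sum_abs _ _).trans ?_
    calc ∑ i ∈ Finset.range (k + 1 + 1), |((k + 1).choose i : ℝ) * iteratedDeriv i χ y *
            iteratedDeriv (k + 1 - i) (fun y => F y - G y) y|
        ≤ ∑ i ∈ Finset.range (k + 1 + 1), ((k + 1).choose i : ℝ) * (B * A) := by
          refine Finset.sum_le_sum fun i hi => ?_
          have hi' : i ≤ k + 1 := by
            have := Finset.mem_range.1 hi
            omega
          rw [abs_mul, abs_mul, Nat.abs_cast, mul_assoc]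
          refine mul_le_mul_of_nonneg_left ?_ (by positivity)
          refine (mul_le_mul (hχB i hi' y hy) (hA (k + 1 - i) (by omega) y
            ⟨hy.1, by linarith [hy.2]⟩) (abs_nonneg _) (by positivity)).trans (le_of_eq ?_)
          field_simp
      _ = 2 ^ (k + 1) * B * A := by
          rw [← Finset.sum_mul]
          have := Nat.sum_range_choose (k + 1)
          have h2 : (∑ i ∈ Finset.range (k + 1 + 1), ((k + 1).choose i : ℝ)) = 2 ^ (k + 1) := by
            exact_mod_cast this
          rw [h2]
          ring
  have hle : t ≤ t + ε := by linarith
  have e1 := edist_jet_le hF hle (M := 0) fun y _ => by simp [hF0]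
  have e2 := edist_jet_le hHc hle hbound
  rw [h0, h1, edist_comm] at e2
  have hM0 : 0 ≤ 2 ^ (k + 1) * B * A := (abs_nonneg _).trans (hbound t ⟨le_rfl, hle⟩)
  refine (edist_triangle _ _ _).trans ((add_le_add e1 e2).trans (le_of_eq ?_))
  rw [← ENNReal.ofReal_add (by simp [hε.le]) (mul_nonneg (by linarith) (by simp [hε.le]))]
  congr 1
  ring

end JetSpace

/-! ### The snowflake estimate for the vertical image of the curve -/

/-- The hypothesis says that `f` is injective on `s` with an `r`-Hölder inverse. -/
lemma dimH_le_dimH_image_div {X Y : Type*} [EMetricSpace X] [EMetricSpace Y] [Nonempty X]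
    {f : X → Y} {s : Set X} {C r : ℝ≥0} (hr : 0 < r)
    (h : ∀ x ∈ s, ∀ y ∈ s, edist x y ≤ C * edist (f x) (f y) ^ (r : ℝ)) :
    dimH s ≤ dimH (f '' s) / r := by
  have hinj : InjOn f s := by
    intro x hx y hy hxy
    have := h x hx y hy
    rw [hxy, edist_self, ENNReal.zero_rpow_of_pos (by exact_mod_cast hr), mul_zero] at this
    exact edist_le_zero.1 this
  have hold : HolderOnWith C r (Function.invFunOn f s) (f '' s) := by
    rintro _ ⟨x, hx, rfl⟩ _ ⟨y, hy, rfl⟩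
    rw [hinj.leftInvOn_invFunOn hx, hinj.leftInvOn_invFunOn hy]
    exact h x hx y hy
  have := hold.dimH_image_le hr
  rwa [hinj.leftInvOn_invFunOn.image_image] at this

/-- This is where `1 ≤ k` enters: an affine function has degree at most `k`. -/
lemma iteratedDeriv_linear {k : ℕ} (hk : 1 ≤ k) (m b y : ℝ) :
    iteratedDeriv (k + 1) (fun x : ℝ => m * x + b) y = 0 := by
  obtain ⟨n, rfl⟩ := Nat.exists_eq_add_of_le' hk
  have h1 : deriv (fun x : ℝ => m * x + b) = fun _ => m := by
    funext x
    simp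
  rw [iteratedDeriv_succ', h1, iteratedDeriv_succ', deriv_const', iteratedDeriv_fun_const_zero]

namespace JetSpace

variable {k : ℕ}

lemma iteratedDeriv_taylorMonomial_sub (t x : ℝ) {i n : ℕ} (h : i ≤ n) (y : ℝ) :
    iteratedDeriv i (fun y => taylorMonomial t n y - taylorMonomial x n y) y =
      taylorMonomial t (n - i) y - taylorMonomial x (n - i) y := by
  rw [iteratedDeriv_fun_sub (contDiff_taylorMonomial t n).contDiffAt
    (contDiff_taylorMonomial x n).contDiffAt, iteratedDeriv_taylorMonomial t h,
    iteratedDeriv_taylorMonomial x h]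

/-- `(y - t)^(k+1) / (k+1)!` has the same `k`-jet at `x` as a polynomial of degree at most `k`. -/
lemma jet_taylorMonomial (t x : ℝ) : jet k (taylorMonomial t (k + 1)) x =
    jet k (fun y => taylorMonomial t (k + 1) y - taylorMonomial x (k + 1) y) x := by
  ext s
  · rfl
  · change iteratedDeriv s _ x = iteratedDeriv s _ x
    rw [iteratedDeriv_taylorMonomial_sub t x s.2.le, iteratedDeriv_taylorMonomial t s.2.le,
      taylorMonomial_self x (by omega), sub_zero]

lemma verticalMap_jet_taylorMonomial {f : ℝ → ℝ} (hf : ContDiff ℝ (k + 1 : ℕ) f)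
    (hf0 : ∀ y, iteratedDeriv (k + 1) f y = 0) (t x : ℝ) :
    verticalMap f t (jet k (taylorMonomial t (k + 1)) x) =
      jet k (fun y => (taylorMonomial t (k + 1) y - taylorMonomial x (k + 1) y) - f (y - t)) t := by
  rw [jet_taylorMonomial]
  refine verticalMap_jet hf hf0
    ((contDiff_taylorMonomial t _).sub (contDiff_taylorMonomial x _)) (fun y => ?_) t x
  rw [iteratedDeriv_taylorMonomial_sub t x le_rfl, Nat.sub_self, taylorMonomial_zero,
    taylorMonomial_zero, sub_self]

/-- Both images are jets at `t` of polynomials of degree at most `k` whose difference has all its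
derivatives of size `O(|x - x'|)` on `[t, t+1]`; the path construction applies with `ε^(k+1) = |x -
x'|`. -/
lemma exists_edist_verticalMap_le {f : ℝ → ℝ} (hf : ContDiff ℝ (k + 1 : ℕ) f)
    (hf0 : ∀ y, iteratedDeriv (k + 1) f y = 0) (t : ℝ) : ∃ C : ℝ≥0,
    HolderOnWith C ((k : ℝ≥0) + 1)⁻¹
      (fun x => verticalMap f t (jet k (taylorMonomial t (k + 1)) x)) (Icc (t + 1) (t + 2)) := by
  obtain ⟨M, hM0, hM⟩ := exists_edist_jet_jet_le k
  refine ⟨Real.toNNReal (2 + M * (((k + 1 : ℕ) : ℝ) * 2 ^ (k + 1))), fun x hx x' hx' => ?_⟩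
  simp only [verticalMap_jet_taylorMonomial hf hf0]
  rcases eq_or_ne x x' with rfl | hne
  · rw [edist_self]
    exact bot_le
  have hft : ContDiff ℝ (k + 1 : ℕ) (fun y => f (y - t)) :=
    hf.comp (contDiff_id.sub contDiff_const)
  have hQ : ∀ x, ContDiff ℝ (k + 1 : ℕ)
      (fun y => taylorMonomial t (k + 1) y - taylorMonomial x (k + 1) y) := fun x =>
    (contDiff_taylorMonomial t _).sub (contDiff_taylorMonomial x _)
  have hQ0 : ∀ x y, iteratedDeriv (k + 1) (fun y =>
      (taylorMonomial t (k + 1) y - taylorMonomial x (k + 1) y) - f (y - t)) y = 0 := by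
    intro x y
    have hft0 : iteratedDeriv (k + 1) (fun y => f (y - t)) y = 0 := by
      rw [iteratedDeriv_comp_sub_const]
      exact hf0 _
    rw [iteratedDeriv_fun_sub (hQ x).contDiffAt hft.contDiffAt, hft0,
      iteratedDeriv_taylorMonomial_sub t x le_rfl, Nat.sub_self, taylorMonomial_zero,
      taylorMonomial_zero, sub_self, sub_zero]
  have hd : 0 < |x - x'| := abs_pos.2 (sub_ne_zero.2 hne)
  have hd1 : |x - x'| ≤ 1 := by
    rw [abs_le]
    constructor <;> linarith [hx.1, hx.2, hx'.1, hx'.2]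
  have hε : (|x - x'| ^ ((k : ℝ) + 1)⁻¹) ^ (k + 1) = |x - x'| := by
    rw [← Real.rpow_natCast, ← Real.rpow_mul hd.le, Nat.cast_succ, inv_mul_cancel₀ (by positivity),
      Real.rpow_one]
  have h := hM _ _ t (|x - x'| ^ ((k : ℝ) + 1)⁻¹) (((k + 1 : ℕ) : ℝ) * 2 ^ (k + 1))
    ((hQ x).sub hft) ((hQ x').sub hft) (hQ0 x) (hQ0 x') (by positivity)
    (Real.rpow_le_one hd.le hd1 (by positivity)) ?_
  · refine h.trans (le_of_eq ?_)
    rw [edist_dist, Real.dist_eq, ENNReal.ofReal_rpow_of_nonneg hd.le (by positivity),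
      ENNReal.ofReal_mul (by positivity)]
    simp [ENNReal.ofReal]
  · intro i hi y hy
    have hfun : (fun y => taylorMonomial t (k + 1) y - taylorMonomial x (k + 1) y - f (y - t) -
        (taylorMonomial t (k + 1) y - taylorMonomial x' (k + 1) y - f (y - t))) =
        fun y => taylorMonomial x' (k + 1) y - taylorMonomial x (k + 1) y := by
      funext y
      ring
    rw [hfun, iteratedDeriv_taylorMonomial_sub x' x hi, hε, abs_sub_comm x]
    refine abs_taylorMonomial_sub_le ?_ ?_ (by omega)
    · rw [abs_le]
      constructor <;> linarith [hy.1, hy.2, hx'.1, hx'.2]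
    · rw [abs_le]
      constructor <;> linarith [hy.1, hy.2, hx.1, hx.2]

/-- Powers expand distances on `[1, ∞)`; this is why the second piece lies over `[t+1, t+2]`. -/
lemma abs_sub_le_abs_pow_sub_pow {a b : ℝ} (ha : 1 ≤ a) (hb : 1 ≤ b) (n : ℕ) :
    |a - b| ≤ |a ^ (n + 1) - b ^ (n + 1)| := by
  wlog hab : b ≤ a generalizing a b
  · rw [abs_sub_comm a, abs_sub_comm (a ^ _)]
    exact this hb ha (le_of_not_ge hab)
  have h1 : b ^ n ≤ a ^ n := pow_le_pow_left₀ (by linarith) hab n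
  have h2 : 1 ≤ b ^ n := one_le_pow₀ hb
  have h3 : a - b ≤ a ^ (n + 1) - b ^ (n + 1) := by
    rw [pow_succ, pow_succ]
    nlinarith
  rw [abs_of_nonneg (by linarith), abs_of_nonneg (by linarith)]
  exact h3

/-- Up to a constant, the coordinate `u_0` of the image is `±(x - t)^(k+1)/(k+1)!`, which separates
points with `x - t ≥ 1`, while `u_0` is controlled by the distance to the power `k+1`. -/
lemma edist_le_edist_verticalMap {f : ℝ → ℝ} (hf : ContDiff ℝ (k + 1 : ℕ) f)
    (hf0 : ∀ y, iteratedDeriv (k + 1) f y = 0) {t x x' : ℝ} (hx : t + 1 ≤ x) (hx' : t + 1 ≤ x') :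
    edist x x' ≤ ((k + 1)! : ℝ≥0) *
      edist (verticalMap f t (jet k (taylorMonomial t (k + 1)) x))
        (verticalMap f t (jet k (taylorMonomial t (k + 1)) x')) ^ ((k : ℝ) + 1) := by
  simp only [verticalMap_jet_taylorMonomial hf hf0]
  have h0 := edist_u_zero_le (k := k)
    (p := jet k (fun y => taylorMonomial t (k + 1) y - taylorMonomial x (k + 1) y - f (y - t)) t)
    (q := jet k (fun y => taylorMonomial t (k + 1) y - taylorMonomial x' (k + 1) y - f (y - t)) t)
    rfl
  refine le_trans ?_ (mul_le_mul_right h0 _)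
  simp only [jet, Fin.val_zero, iteratedDeriv_zero]
  rw [edist_dist, edist_dist, Real.dist_eq, Real.dist_eq, ENNReal.coe_natCast,
    ← ENNReal.ofReal_natCast, ← ENNReal.ofReal_mul (by positivity)]
  refine ENNReal.ofReal_le_ofReal ?_
  have h1 : (0 : ℝ) < ((k + 1)! : ℕ) := by positivity
  have h2 := abs_sub_le_abs_pow_sub_pow (a := x - t) (b := x' - t) (by linarith) (by linarith) k
  rw [sub_sub_sub_cancel_right] at h2
  refine h2.trans (le_of_eq ?_)
  have h3 : taylorMonomial t (k + 1) t - taylorMonomial x (k + 1) t - f (t - t) -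
      (taylorMonomial t (k + 1) t - taylorMonomial x' (k + 1) t - f (t - t)) =
      (-1) ^ (k + 1) * (((x' - t) ^ (k + 1) - (x - t) ^ (k + 1)) / ((k + 1)! : ℕ)) := by
    simp only [taylorMonomial]
    rw [← neg_sub x t, ← neg_sub x' t, neg_pow (x - t), neg_pow (x' - t)]
    ring
  rw [h3, abs_mul, abs_pow, abs_neg, abs_one, one_pow, one_mul, abs_div, abs_of_pos h1,
    mul_div_cancel₀ _ h1.ne', abs_sub_comm]

lemma dimH_verticalMap_image {f : ℝ → ℝ} (hf : ContDiff ℝ (k + 1 : ℕ) f)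
    (hf0 : ∀ y, iteratedDeriv (k + 1) f y = 0) {t : ℝ} {C : Set ℝ} (hC : C ⊆ Icc (t + 1) (t + 2)) :
    dimH (verticalMap f t '' (jet k (taylorMonomial t (k + 1)) '' C)) = (k + 1) * dimH C := by
  have hk : (0 : ℝ≥0) < (k : ℝ≥0) + 1 := by positivity
  have hk' : ((((k : ℝ≥0) + 1 : ℝ≥0)) : ℝ≥0∞) = k + 1 := by simp
  rw [image_image]
  refine le_antisymm ?_ ?_
  · obtain ⟨K, hK⟩ := exists_edist_verticalMap_le hf hf0 t
    have h := (hK.mono hC).dimH_image_le (inv_pos.2 hk)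
    rwa [ENNReal.coe_inv hk.ne', hk', ENNReal.div_eq_inv_mul, inv_inv] at h
  · have h := dimH_le_dimH_image_div hk (C := ((k + 1)! : ℝ≥0)) (s := C)
      (f := fun x => verticalMap f t (jet k (taylorMonomial t (k + 1)) x))
      fun x hx x' hx' => by
        have := edist_le_edist_verticalMap hf hf0 (hC hx).1 (hC hx').1
        simpa using this
    rwa [hk', ENNReal.le_div_iff_mul_le (by simp) (by simp), mul_comm] at h

end JetSpace

/-! ### Construction of the set -/

theorem mainTheorem11 (k : ℕ) (hk : 1 ≤ k) (t m b : ℝ) (hm : m ≠ 0) (μ β : ℝ)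
    (hμ₀ : 0 ≤ μ) (hμ₁ : μ ≤ 1) (hβ₀ : 0 ≤ β) (hβ₁ : β ≤ (k + 1) * μ) :
    ∃ E : Set (JetSpace k), MeasurableSet E ∧
      dimH E = ENNReal.ofReal μ ∧
      dimH (JetSpace.verticalMap (fun x : ℝ => m * x + b) t '' E) = ENNReal.ofReal β := by
  have hk0 : (0 : ℝ) < (k : ℝ) + 1 := by positivity
  have hα : β / (k + 1) ≤ μ := by
    rw [div_le_iff₀ hk0]
    linarith
  obtain ⟨A, hA, -, hAd⟩ := exists_isCompact_dimH_eq μ.toNNReal (Real.toNNReal_le_one.2 hμ₁)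
  obtain ⟨B, hB, hBI, hBd⟩ := exists_isCompact_dimH_eq (β / (k + 1)).toNNReal
    (Real.toNNReal_le_one.2 (hα.trans hμ₁))
  have hf : ContDiff ℝ (k + 1 : ℕ) (fun x : ℝ => m * x + b) := by fun_prop
  have hf0 := iteratedDeriv_linear hk m b
  set B' : Set ℝ := (fun x => t + 1 + x) '' B with hB'
  have hBd' : dimH B' = ENNReal.ofReal (β / (k + 1)) :=
    ((IsometryEquiv.addLeft (t + 1)).dimH_image B).trans hBd
  have hBI' : B' ⊆ Icc (t + 1) (t + 2) := by
    rintro _ ⟨x, hx, rfl⟩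
    have := hBI hx
    constructor <;> linarith [this.1, this.2]
  have hBc : IsCompact B' := hB.image (by fun_prop)
  have hG : ContDiff ℝ (k + 1 : ℕ) (taylorMonomial t (k + 1)) := contDiff_taylorMonomial t _
  have hGM : ∀ y, |iteratedDeriv (k + 1) (taylorMonomial t (k + 1)) y| ≤ 1 := by
    intro y
    rw [iteratedDeriv_taylorMonomial t le_rfl, Nat.sub_self, taylorMonomial_zero, abs_one]
  have hZ : ContDiff ℝ (k + 1 : ℕ) (fun _ : ℝ => (0 : ℝ)) := contDiff_const
  have hZ0 : ∀ y, iteratedDeriv (k + 1) (fun _ : ℝ => (0 : ℝ)) y = 0 := fun y =>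
    iteratedDeriv_fun_const_zero
  have hZM : ∀ y, |iteratedDeriv (k + 1) (fun _ : ℝ => (0 : ℝ)) y| ≤ 0 := fun y => by
    rw [hZ0, abs_zero]
  refine ⟨JetSpace.jet k (fun _ => 0) '' A ∪ JetSpace.jet k (taylorMonomial t (k + 1)) '' B',
    ?_, ?_, ?_⟩
  -- `E` is compact, as a union of two continuous images of compact sets.
  · exact ((hA.image (JetSpace.lipschitzWith_jet hZ hZM).continuous).union
      (hBc.image (JetSpace.lipschitzWith_jet hG hGM).continuous)).isClosed.measurableSet
  · rw [dimH_union, JetSpace.dimH_image_jet hZ hZM, JetSpace.dimH_image_jet hG hGM, hAd, hBd']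
    exact max_eq_left (ENNReal.ofReal_le_ofReal hα)
  -- All points of the jet of the zero function have the same image `j^k_t(-f(· - t))`.
  · have h1 : (JetSpace.verticalMap (fun x : ℝ => m * x + b) t ''
        (JetSpace.jet k (fun _ => 0) '' A)).Subsingleton := by
      rintro _ ⟨_, ⟨x, -, rfl⟩, rfl⟩ _ ⟨_, ⟨y, -, rfl⟩, rfl⟩
      rw [JetSpace.verticalMap_jet hf hf0 hZ hZ0, JetSpace.verticalMap_jet hf hf0 hZ hZ0]
    rw [image_union, dimH_union, dimH_subsingleton h1, JetSpace.dimH_verticalMap_image hf hf0 hBI',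
      hBd', max_eq_right zero_le]
    have h2 : ((k : ℝ≥0∞) + 1) = ENNReal.ofReal ((k : ℝ) + 1) := by
      rw [ENNReal.ofReal_add (by positivity) (by positivity)]
      simp
    rw [h2, ← ENNReal.ofReal_mul hk0.le, mul_div_cancel₀ _ hk0.ne']
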